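/- Let $K$ be a field with an absolute value $|\cdot|$ (archimedean or not), let $d\ge 2$, and let $\varphi=[F_1:F_2]$ be a rational map of degree $d$ over $K$, where $F=(F_1,F_2)$ is a pair of homogeneous polynomials of degree $d$ in $K[x,y]$ with no common linear factor over $\overline K$. Write $\|(z_0,z_1)\|=\max(|z_0|,|z_1|)$, $(z_0,z_1)\wedge(w_0,w_1)=z_0w_1-z_1w_0$, $\hat H_F(z)=\lim_{n\to\infty} d^{-n}\log\|F^{(n)}(z)\|$ for $z\in K^2\setminus\{0\}$ (where $F^{(n)}$ is the $n$-th iterate), and $r(F)=\frac{1}{d(d-1)}\log|\operatorname{Res}(F_1,F_2)|$, where $\operatorname{Res}$ is the homogeneous resultant. For distinct $z,w\in\mathbb P^1(K)$ with lifts $\tilde z,\tilde w\in K^2$ put $$g_\varphi(z,w)=-\log|\tilde z\wedge\tilde w|+\hat H_F(\tilde z)+\hat H_F(\tilde w)-r(F)$$ (independent of the lifts), and put $g_\varphi(z,z)=+\infty$. Let $\epsilon_K=0$ if $|\cdot|$ is non-archimedean and $\epsilon_K=1$ otherwise. (1) Let $L\supseteq K$ be any field with an absolute value extending that of $K$ which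 is either trivial or has value group $|L^*|$ dense in $\mathbb R_{>0}$ (for example $L=\overline K$, or $L=K$ if $K$ itself has this property). Let $K_F\subseteq L^2$ be the filled Julia set, i.e. the set of $z\in L^2$ whose iterates $F^{(n)}(z)$ stay bounded. Then there is a smallest radius $R(F)$ with $K_F\subseteq\{z\in L^2:\|z\|\le R(F)\}$, it is positive, and whenever $N=td^k$ with integers $2\le t\le 2d-1$ and $k\ge 1$, and $z_1,\dots,z_N\in\mathbb P^1(K)$ are distinct, $$\sum_{i\ne j}g_\varphi(z_i,z_j)\ \ge\ -\epsilon_K N\log N-\bigl(2\log R(F)+r(F)\bigr)\alpha N,\qquad \alpha=t-1+(d-1)k.$$ (2) For every such $K$ and $\varphi$ (with no condition on the value group), $$\liminf_{N\to\infty}\ \inf_{z_1,\dots,z_N\in\mathbb P^1(K)}\ \frac{1}{N(N-1)}\sum_{i\ne j}g_\varphi(z_i,z_j)\ \ge\ 0,$$ where the infimum is taken in $[-\infty,+\infty]$. -/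

import Mathlib

open Filter Topology

noncomputable section

namespace DynGreen

/-- `F = (F₁, F₂)` is a lift of a rational map of degree `d` over `K`: two forms of degree `d` in
`K[x, y]` (`x = X 0`, `y = X 1`) having no common linear factor over the algebraic closure. -/
structure IsLift {K : Type*} [Field K] (d : ℕ) (F : Fin 2 → MvPolynomial (Fin 2) K) : Prop where
  homogeneous : ∀ i, (F i).IsHomogeneous d
  no_common_factor : ∀ a b : AlgebraicClosure K, (a ≠ 0 ∨ b ≠ 0) →
    ¬ ∀ i, (MvPolynomial.C a * MvPolynomial.X 0 + MvPolynomial.C b * MvPolynomial.X 1 :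
        MvPolynomial (Fin 2) (AlgebraicClosure K)) ∣
      MvPolynomial.map (algebraMap K (AlgebraicClosure K)) (F i)

/-- The self-map `(z₀, z₁) ↦ (F₁(z₀, z₁), F₂(z₀, z₁))` of `L²`, for an extension `L` of `K`. -/
def polyMap {K : Type*} (L : Type*) [Field K] [Field L] [Algebra K L]
    (F : Fin 2 → MvPolynomial (Fin 2) K) (z : Fin 2 → L) : Fin 2 → L :=
  fun i => MvPolynomial.aeval z (F i)

/-- The norm `‖(z₀, z₁)‖ = max(|z₀|, |z₁|)`. -/
def supNorm {L : Type*} [Field L] (w : AbsoluteValue L ℝ) (z : Fin 2 → L) : ℝ :=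
  max (w (z 0)) (w (z 1))

/-- The filled Julia set of `F` in `L²`: the points with bounded forward orbit. -/
def filledJulia {K L : Type*} [Field K] [Field L] [Algebra K L] (w : AbsoluteValue L ℝ)
    (F : Fin 2 → MvPolynomial (Fin 2) K) : Set (Fin 2 → L) :=
  {z | ∃ B : ℝ, ∀ n : ℕ, supNorm w ((polyMap L F)^[n] z) ≤ B}

/-- The homogeneous local dynamical height `lim d⁻ⁿ log ‖F⁽ⁿ⁾(z)‖` of a nonzero vector `z`
(the value at `z = 0` is not meaningful and never used). -/
def localHeight {K : Type*} [Field K] (v : AbsoluteValue K ℝ) (d : ℕ)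
    (F : Fin 2 → MvPolynomial (Fin 2) K) (z : Fin 2 → K) : ℝ :=
  limUnder atTop
    (fun n : ℕ => (1 / (d : ℝ) ^ n) * Real.log (supNorm v ((polyMap K F)^[n] z)))

/-- The homogeneous resultant of the two forms `F₁, F₂` of degree `d`: the determinant of the
`2d × 2d` Sylvester matrix of their coefficients. Each form is given by the coefficients of
`F_i(X, 1)`, regarded as a polynomial of formal degree `d`. -/
def homResultant {K : Type*} [Field K] (d : ℕ) (F : Fin 2 → MvPolynomial (Fin 2) K) : K :=
  Polynomial.resultant
    (MvPolynomial.aeval ![(Polynomial.X : Polynomial K), 1] (F 0))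
    (MvPolynomial.aeval ![(Polynomial.X : Polynomial K), 1] (F 1)) d d

/-- `r(F) = log |Res(F)| / (d (d - 1))`. -/
def rConst {K : Type*} [Field K] (v : AbsoluteValue K ℝ) (d : ℕ)
    (F : Fin 2 → MvPolynomial (Fin 2) K) : ℝ :=
  1 / ((d : ℝ) * ((d : ℝ) - 1)) * Real.log (v (homResultant d F))

/-- `G_F(z, w) = -log |z ∧ w| + H(z) + H(w) - r(F)`, for linearly independent `z, w ∈ K²`. -/
def homGreen {K : Type*} [Field K] (v : AbsoluteValue K ℝ) (d : ℕ)
    (F : Fin 2 → MvPolynomial (Fin 2) K) (z w : Fin 2 → K) : ℝ :=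
  -Real.log (v (z 0 * w 1 - z 1 * w 0)) + localHeight v d F z + localHeight v d F w
    - rConst v d F

open Classical in
/-- The normalized Arakelov-Green's function on `P¹(K)`, with value `+∞` on the diagonal.
As `G_F` is invariant under scaling of either variable, any choice of nonzero representatives
of the two points gives the same value. -/
def green {K : Type*} [Field K] (v : AbsoluteValue K ℝ) (d : ℕ)
    (F : Fin 2 → MvPolynomial (Fin 2) K) (P Q : Projectivization K (Fin 2 → K)) : EReal :=
  if P = Q then ⊤ else ((homGreen v d F P.rep Q.rep : ℝ) : EReal)

/-- The discriminant sum `∑_{i ≠ j} g(z_i, z_j)` over ordered pairs. -/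
def greenSum {K : Type*} [Field K] (v : AbsoluteValue K ℝ) (d : ℕ)
    (F : Fin 2 → MvPolynomial (Fin 2) K) {N : ℕ} (z : Fin N → Projectivization K (Fin 2 → K)) :
    EReal :=
  ∑ i : Fin N, ∑ j ∈ Finset.univ.erase i, green v d F (z i) (z j)

open Classical in
/-- `0` for a non-archimedean absolute value and `1` for an archimedean one. -/
def archEps {K : Type*} [Field K] (v : AbsoluteValue K ℝ) : ℝ :=
  if IsNonarchimedean v then 0 else 1

/-- The absolute value is trivial, or its value group is dense in the positive reals
(that is, it is not a nontrivial discrete one). -/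
def TrivialOrDense {L : Type*} [Field L] (w : AbsoluteValue L ℝ) : Prop :=
  (∀ x : L, x ≠ 0 → w x = 1) ∨ ∀ a b : ℝ, 0 < a → a < b → ∃ x : L, a < w x ∧ w x < b

end DynGreen

end

noncomputable section

namespace DynGreen

/-! The sum of `-log |z_i ∧ z_j|` over ordered pairs is minus the logarithm of the squared
determinant of the homogeneous Vandermonde matrix whose rows are all monomials of degree `N - 1` at
`z_i`. Hadamard's inequality applied to it directly loses a multiple of `N ^ 2`, because each
monomial is controlled by `‖z‖ ^ (N - 1)` and not by `exp ((N - 1) H(z))`.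

The remedy is to change the basis of forms of degree `N - 1`. For `N = t d ^ k` one builds
recursively a basis of products of a monomial of degree `d - 1` at `z` with a form of the previous
level at `F(z)` (`exists_adapted_basis`). Since `H(F(z)) = d H(z)`, each level costs only `d - 1`
copies of a bound `C` for `log ‖z‖ - H(z)`, so the total loss per row is `α C` with `α = t - 1 + (d
- 1) k`, logarithmic in `N`. The transition determinant is, up to sign, a product of Sylvester
determinants, so its square is a power of the resultant (`det_coeffMatrix_mixedProducts_sq`), and
that power nearly cancels the term `r(F)` in `g`. Hadamard's inequality (`abs_det_sq_le`) then gives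
`sum_homGreen_ge`.

For (1) one takes `C = log R(F)`: density of the value group allows any `z` to be scaled almost to
the edge of the filled Julia set (`radius_pos_and_log_supNorm_le`). For (2) any `C` from Tate's
telescoping argument suffices, hence no condition on values. The bound for the special sizes `2 d ^
k` passes to all larger `N` by averaging over subsets (`le_sum_offDiag_of_card_le`). -/

/-! ### Hadamard's inequality over the complex numbers. -/

open scoped ComplexOrder in
theorem norm_det_sq_le_of_norm_le_one {ι : Type*} [Fintype ι] [DecidableEq ι]
    (A : Matrix ι ι ℂ) (hA : ∀ i j, ‖A i j‖ ≤ 1) :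
    ‖A.det‖ ^ 2 ≤ (Fintype.card ι : ℝ) ^ Fintype.card ι := by
  classical
  rcases isEmpty_or_nonempty ι with hι | hι
  · simp
  set n := Fintype.card ι with hn
  have hn0 : 0 < (n : ℝ) := by exact_mod_cast Fintype.card_pos
  have hG : (A * A.conjTranspose).PosSemidef := Matrix.posSemidef_self_mul_conjTranspose A
  set μ := hG.isHermitian.eigenvalues with hμ
  have hμ0 : ∀ i, 0 ≤ μ i := hG.eigenvalues_nonneg
  have hdet : ‖A.det‖ ^ 2 = ∏ i, μ i := by
    have h1 := hG.isHermitian.det_eq_prod_eigenvalues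
    rw [Matrix.det_mul, Matrix.det_conjTranspose, ← starRingEnd_apply, Complex.mul_conj,
      Complex.normSq_eq_norm_sq] at h1
    refine Complex.ofReal_injective ?_
    rw [Complex.ofReal_prod]
    exact h1
  have htr : ∑ i, μ i ≤ (n : ℝ) * n := by
    have h1 := hG.isHermitian.trace_eq_sum_eigenvalues
    have h2 : (A * A.conjTranspose).trace = ((∑ i, ∑ j, ‖A i j‖ ^ 2 : ℝ) : ℂ) := by
      simp only [Matrix.trace, Matrix.diag, Matrix.mul_apply, Matrix.conjTranspose_apply]
      push_cast
      refine Finset.sum_congr rfl fun i _ => Finset.sum_congr rfl fun j _ => ?_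
      rw [← starRingEnd_apply, Complex.mul_conj, Complex.normSq_eq_norm_sq]
      push_cast
      rfl
    have h3 : ∑ i, μ i = ∑ i, ∑ j, ‖A i j‖ ^ 2 := by
      rw [h2] at h1
      refine Complex.ofReal_injective ?_
      rw [Complex.ofReal_sum]
      exact h1.symm
    rw [h3]
    calc ∑ i, ∑ j, ‖A i j‖ ^ 2 ≤ ∑ _i : ι, ∑ _j : ι, (1 : ℝ) := by
          gcongr with i _ j _
          exact pow_le_one₀ (norm_nonneg _) (hA i j)
      _ = (n : ℝ) * n := by simp [hn]
  have hw : ∑ _i : ι, (n : ℝ)⁻¹ = 1 := by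
    rw [Finset.sum_const, Finset.card_univ, nsmul_eq_mul, mul_inv_cancel₀ hn0.ne']
  -- AM-GM for the eigenvalues of `A A*`: their product is `|det A| ^ 2`, and their sum is the
  -- squared Frobenius norm, at most `n ^ 2`.
  have hamgm := Real.geom_mean_le_arith_mean_weighted Finset.univ (fun _ : ι => (n : ℝ)⁻¹) μ
    (fun _ _ => by positivity) hw (fun i _ => hμ0 i)
  rw [Real.finsetProd_rpow _ _ (fun i _ => hμ0 i), ← Finset.mul_sum] at hamgm
  have hle : (∏ i, μ i) ^ (n : ℝ)⁻¹ ≤ n :=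
    hamgm.trans (by rw [inv_mul_le_iff₀ hn0]; exact htr)
  rw [hdet]
  calc ∏ i, μ i = ((∏ i, μ i) ^ (n : ℝ)⁻¹) ^ n := by
        rw [Real.rpow_inv_natCast_pow (Finset.prod_nonneg fun i _ => hμ0 i)]
        exact Fintype.card_ne_zero
    _ ≤ (n : ℝ) ^ n := by
        gcongr
        exact Real.rpow_nonneg (Finset.prod_nonneg fun i _ => hμ0 i) _

/-- **Hadamard's inequality**, for entries bounded row by row. -/
theorem norm_det_sq_le {ι : Type*} [Fintype ι] [DecidableEq ι]
    (A : Matrix ι ι ℂ) (b : ι → ℝ) (hb : ∀ i, 0 < b i) (hA : ∀ i j, ‖A i j‖ ≤ b i) :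
    ‖A.det‖ ^ 2 ≤ (Fintype.card ι : ℝ) ^ Fintype.card ι * (∏ i, b i) ^ 2 := by
  have h := norm_det_sq_le_of_norm_le_one (Matrix.of fun i j => ((b i)⁻¹ : ℂ) * A i j) fun i j => by
    simp only [Matrix.of_apply, norm_mul, norm_inv, Complex.norm_real, Real.norm_eq_abs,
      abs_of_pos (hb i)]
    rw [inv_mul_le_iff₀ (hb i), mul_one]
    exact hA i j
  have hP : 0 < ∏ i, b i := Finset.prod_pos fun i _ => hb i
  rw [Matrix.det_mul_column, norm_mul, Finset.prod_inv_distrib, norm_inv, ← Complex.ofReal_prod,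
    Complex.norm_real, Real.norm_eq_abs, abs_of_pos hP, mul_pow, inv_pow,
    inv_mul_le_iff₀ (by positivity), mul_comm] at h
  exact h

/-! ### Archimedean absolute values and embeddings into `ℂ`. -/

/-- The power trick: polynomial factors in `n` disappear after taking `n`-th roots. -/
theorem le_of_forall_pow_le_mul_pow {u w C : ℝ} (hw : 0 ≤ w)
    (h : ∀ n : ℕ, u ^ n ≤ C * ((n : ℝ) + 1) * w ^ n) : u ≤ w := by
  rcases hw.eq_or_lt with rfl | hw
  · simpa using h 1
  by_contra! hlt
  have hr : 1 < u / w := (one_lt_div hw).2 hlt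
  have h2 := ((tendsto_pow_const_div_const_pow_of_one_lt 1 hr).add
    (tendsto_pow_const_div_const_pow_of_one_lt 0 hr)).const_mul C
  obtain ⟨n, hn⟩ := (h2.eventually
    (gt_mem_nhds (show C * ((0 : ℝ) + 0) < 1 by norm_num))).exists
  have h3 := h n
  have hu : 0 < u := hw.trans hlt
  rw [pow_one, pow_zero, ← add_div, mul_div_assoc', div_lt_one (by positivity), div_pow,
    lt_div_iff₀ (by positivity)] at hn
  linarith

/-- Taking the root `x ↦ |x|^{1/s}` of an absolute value that is `n ↦ n^s` on natural numbers
keeps the triangle inequality. -/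
def rootAbs {K : Type*} [Field K] (v : AbsoluteValue K ℝ) (s : ℝ) (hs : 0 < s)
    (h : ∀ n : ℕ, v n = (n : ℝ) ^ s) : AbsoluteValue K ℝ where
  toFun x := v x ^ s⁻¹
  map_mul' x y := by rw [map_mul, Real.mul_rpow (v.nonneg _) (v.nonneg _)]
  nonneg' x := Real.rpow_nonneg (v.nonneg _) _
  eq_zero' x := by
    rw [Real.rpow_eq_zero (v.nonneg _) (inv_ne_zero hs.ne'), v.eq_zero]
  add_le' x y := by
    set a := v x ^ s⁻¹ with ha
    set b := v y ^ s⁻¹ with hb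
    have ha0 : 0 ≤ a := Real.rpow_nonneg (v.nonneg _) _
    have hb0 : 0 ≤ b := Real.rpow_nonneg (v.nonneg _) _
    have hva : v x = a ^ s := by rw [ha, Real.rpow_inv_rpow (v.nonneg _) hs.ne']
    have hvb : v y = b ^ s := by rw [hb, Real.rpow_inv_rpow (v.nonneg _) hs.ne']
    clear_value a b
    suffices v (x + y) ≤ (a + b) ^ s by
      calc v (x + y) ^ s⁻¹ ≤ ((a + b) ^ s) ^ s⁻¹ :=
            Real.rpow_le_rpow (v.nonneg _) this (by positivity)
        _ = a + b := Real.rpow_rpow_inv (by positivity) hs.ne'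
    -- Expand `(x + y) ^ n`. Since a binomial coefficient has absolute value its own `s`-th power,
    -- each of the `n + 1` terms is at most the `s`-th power of the matching term of `(a + b) ^ n`.
    refine le_of_forall_pow_le_mul_pow (C := 1) (Real.rpow_nonneg (by positivity) _)
      fun n => ?_
    rw [one_mul, ← map_pow, add_pow]
    refine (v.sum_le _ _).trans ?_
    calc ∑ m ∈ Finset.range (n + 1), v (x ^ m * y ^ (n - m) * (n.choose m : K))
        ≤ ∑ _m ∈ Finset.range (n + 1), ((a + b) ^ s) ^ n := by
          refine Finset.sum_le_sum fun m hm => ?_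
          rw [map_mul, map_mul, map_pow, map_pow, h, hva, hvb, Real.rpow_pow_comm ha0,
            Real.rpow_pow_comm hb0, Real.rpow_pow_comm (by positivity),
            ← Real.mul_rpow (by positivity) (by positivity),
            ← Real.mul_rpow (by positivity) (by positivity)]
          refine Real.rpow_le_rpow (by positivity) ?_ hs.le
          rw [add_pow]
          exact Finset.single_le_sum (f := fun m => a ^ m * b ^ (n - m) * (n.choose m : ℝ))
            (fun i _ => by positivity) hm
      _ = ((n : ℝ) + 1) * ((a + b) ^ s) ^ n := by
          simp

theorem exists_one_lt_natCast_of_not_isNonarchimedean {K : Type*} [Field K]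
    (v : AbsoluteValue K ℝ) (hv : ¬ IsNonarchimedean v) : ∃ n : ℕ, 1 < v n := by
  by_contra! h
  let := v.toNormedField
  have : IsUltrametricDist K :=
    IsUltrametricDist.isUltrametricDist_of_forall_norm_natCast_le_one (R := K) h
  exact hv fun x y => IsUltrametricDist.norm_add_le_max x y

/-- In positive characteristic the natural numbers have finite image, so their absolute values are
bounded, whereas the powers of `n` are not. -/
theorem charZero_of_one_lt_natCast {K : Type*} [Field K] (v : AbsoluteValue K ℝ) (n : ℕ)
    (hn : 1 < v n) : CharZero K := by
  obtain ⟨p, hp⟩ := CharP.exists K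
  rcases Nat.eq_zero_or_pos p with rfl | hp0
  · exact CharP.charP_to_charZero K
  exfalso
  have hb : ∀ m : ℕ, v m ≤ ∑ r ∈ Finset.range p, v (r : K) := fun m => by
    rw [← Nat.mod_add_div m p, Nat.cast_add, Nat.cast_mul, CharP.cast_eq_zero K p, zero_mul,
      add_zero]
    exact Finset.single_le_sum (f := fun r : ℕ => v (r : K)) (fun i _ => v.nonneg _)
      (Finset.mem_range.2 (Nat.mod_lt _ hp0))
  obtain ⟨k, hk⟩ := pow_unbounded_of_one_lt (∑ r ∈ Finset.range p, v (r : K)) hn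
  have := hb (n ^ k)
  rw [Nat.cast_pow, map_pow] at this
  linarith

/-- Ostrowski's theorem over `ℚ`, applied to the restriction of `v`. The exponent is at most `1`
because `v 2 ≤ 2`. -/
theorem exists_natCast_eq_rpow {K : Type*} [Field K] (v : AbsoluteValue K ℝ)
    (hv : ¬ IsNonarchimedean v) : ∃ s : ℝ, 0 < s ∧ s ≤ 1 ∧ ∀ n : ℕ, v n = (n : ℝ) ^ s := by
  obtain ⟨n, hn⟩ := exists_one_lt_natCast_of_not_isNonarchimedean v hv
  have := charZero_of_one_lt_natCast v n hn
  have hinj : Function.Injective (Rat.castHom K) := (Rat.castHom K).injective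
  have heq := Rat.AbsoluteValue.equiv_real_of_unbounded (f := v.comp hinj) (by
    push Not
    exact ⟨n, by
      show 1 < v (Rat.castHom K n)
      simpa using hn⟩)
  obtain ⟨c, hc, h⟩ := Rat.AbsoluteValue.exists_nat_rpow_iff_isEquiv.2 heq
  have hs : ∀ m : ℕ, v m = (m : ℝ) ^ c⁻¹ := fun m => by
    have h1 := h m
    have h2 : (v.comp hinj) (m : ℚ) = v m := by
      show v (Rat.castHom K m) = v m
      simp
    rw [h2, Rat.AbsoluteValue.real_eq_abs] at h1
    have h3 : ((|(m : ℚ)| : ℚ) : ℝ) = m := by simp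
    rw [h3] at h1
    rw [← h1, Real.rpow_rpow_inv (v.nonneg _) hc.ne']
  refine ⟨c⁻¹, inv_pos.2 hc, ?_, hs⟩
  have h2 : v ((2 : ℕ) : K) ≤ 2 := by
    have := v.add_le 1 1
    rw [map_one] at this
    norm_num at this ⊢
    exact this
  rw [hs] at h2
  by_contra! hlt
  have := Real.rpow_lt_rpow_of_exponent_lt (x := ((2 : ℕ) : ℝ)) (by norm_num) hlt
  rw [Real.rpow_one] at this
  norm_num at this h2
  linarith

theorem norm_le_of_forall_norm_le_mul {A B : Type*} [NormedField A] [NormedField B]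
    (g : A →+* B) (C : ℝ) (h : ∀ x, ‖g x‖ ≤ C * ‖x‖) (x : A) : ‖g x‖ ≤ ‖x‖ := by
  refine le_of_forall_pow_le_mul_pow (C := C) (norm_nonneg _) fun n => ?_
  have h1 := h (x ^ n)
  rw [map_pow, norm_pow, norm_pow] at h1
  have hC : 0 ≤ C := by
    have := (norm_nonneg _).trans (h 1)
    simpa using this
  have : 0 ≤ C * n * ‖x‖ ^ n := by positivity
  linarith

/-- A field whose absolute value is the usual one on natural numbers embeds isometrically
into `ℂ` (**Ostrowski**). -/
theorem exists_ringHom_complex {K : Type*} [NormedField K] (h : ∀ n : ℕ, ‖(n : K)‖ = n) :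
    ∃ σ : K →+* ℂ, ∀ x, ‖σ x‖ = ‖x‖ := by
  have : CharZero K := charZero_of_one_lt_natCast (NormedField.toAbsoluteValue K) 2 (by
    show 1 < ‖((2 : ℕ) : K)‖
    rw [h]; norm_num)
  let F := UniformSpace.Completion K
  let ι : K →+* F := UniformSpace.Completion.coeRingHom
  have hι : ∀ x, ‖ι x‖ = ‖x‖ := fun x => UniformSpace.Completion.norm_coe x
  let f : ℚ →+* F := ι.comp (Rat.castHom K)
  have hf : ∀ q : ℚ, ‖f q‖ = ‖q‖ := fun q => by
    show ‖ι (q : K)‖ = _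
    rw [hι, Rat.cast_def, norm_div, h]
    have h1 : ‖((q.num : ℤ) : K)‖ = |(q.num : ℝ)| := by
      obtain ⟨m, hm | hm⟩ := Int.eq_nat_or_neg q.num <;> rw [hm] <;> simp [h]
    rw [h1, ← Rat.norm_cast_real, Real.norm_eq_abs, Rat.cast_def q, abs_div, Nat.abs_cast]
  have hfu : UniformContinuous f :=
    (AddMonoidHomClass.isometry_of_norm f hf).uniformContinuous
  let i : ℚ →+* ℝ := Rat.castHom ℝ
  have hi : IsUniformInducing i := Rat.isUniformEmbedding_coe_real.isUniformInducing
  have hd : DenseRange i := Rat.isDenseEmbedding_coe_real.dense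
  -- The completion contains the closure of `ℚ`, a copy of `ℝ`. It is thus a real normed algebra and
  -- a field, and Gelfand–Mazur identifies it with `ℝ` or `ℂ`.
  let φ : ℝ →+* F := IsDenseInducing.extendRingHom hi hd hfu
  have hφc : Continuous φ := (uniformContinuous_uniformly_extend hi hd hfu).continuous
  have hφi : ∀ q : ℚ, φ q = f q := fun q =>
    IsDenseInducing.extend_eq (hi.isDenseInducing hd) hfu.continuous q
  have hφ : ∀ r, ‖φ r‖ = ‖r‖ := fun r => by
    have h1 : (fun r => ‖φ r‖) = fun r : ℝ => ‖r‖ :=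
      hd.equalizer (by fun_prop) (by fun_prop) (funext fun q => by
        show ‖φ (q : ℝ)‖ = ‖(q : ℝ)‖
        rw [hφi, hf]; rfl)
    exact congrFun h1 r
  let : NormedAlgebra ℝ F :=
    { φ.toAlgebra with
      norm_smul_le := fun r x => by
        show ‖φ r * x‖ ≤ _
        rw [norm_mul, hφ] }
  -- The algebra isomorphism is only algebraic. Finite dimension makes it and its inverse bounded,
  -- and multiplicativity of the norms upgrades bounded to isometric.
  have hiso : ∀ (E : Type) [NormedField E] [NormedAlgebra ℝ E] [FiniteDimensional ℝ E]
      (e : F ≃ₐ[ℝ] E) (x : F), ‖e x‖ = ‖x‖ := by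
    intro E _ _ _ e
    have : FiniteDimensional ℝ F := e.symm.toLinearEquiv.finiteDimensional
    let e' := e.toLinearEquiv.toContinuousLinearEquiv
    have e1 (x : F) : ‖e x‖ ≤ ‖x‖ :=
      norm_le_of_forall_norm_le_mul (e : F →+* E) ‖(e' : F →L[ℝ] E)‖
        (fun x => (e' : F →L[ℝ] E).le_opNorm x) x
    have e2 (y : E) : ‖e.symm y‖ ≤ ‖y‖ :=
      norm_le_of_forall_norm_le_mul (e.symm : E →+* F) ‖(e'.symm : E →L[ℝ] F)‖
        (fun y => (e'.symm : E →L[ℝ] F).le_opNorm y) y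
    exact fun x => le_antisymm (e1 x) (by simpa using e2 (e x))
  rcases NormedAlgebra.Real.nonempty_algEquiv_or F with ⟨⟨e⟩⟩ | ⟨⟨e⟩⟩
  · refine ⟨(Complex.ofRealHom.comp (e : F →+* ℝ)).comp ι, fun x => ?_⟩
    show ‖((e (ι x) : ℝ) : ℂ)‖ = _
    rw [Complex.norm_real, hiso, hι]
  · refine ⟨(e : F →+* ℂ).comp ι, fun x => ?_⟩
    show ‖e (ι x)‖ = _
    rw [hiso, hι]

/-- **Ostrowski's theorem**: an archimedean absolute value is a power of the absolute value
induced by an embedding into `ℂ`. -/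
theorem exists_ringHom_complex_rpow {K : Type*} [Field K] (v : AbsoluteValue K ℝ)
    (hv : ¬ IsNonarchimedean v) :
    ∃ s : ℝ, 0 < s ∧ s ≤ 1 ∧ ∃ σ : K →+* ℂ, ∀ x, v x = ‖σ x‖ ^ s := by
  obtain ⟨s, hs0, hs1, h⟩ := exists_natCast_eq_rpow v hv
  let _ := (rootAbs v s hs0 h).toNormedField
  obtain ⟨σ, hσ⟩ := exists_ringHom_complex (K := K) fun n => by
    show v n ^ s⁻¹ = n
    rw [h, Real.rpow_rpow_inv (by positivity) hs0.ne']
  refine ⟨s, hs0, hs1, σ, fun x => ?_⟩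
  rw [hσ]
  show v x = (v x ^ s⁻¹) ^ s
  rw [Real.rpow_inv_rpow (v.nonneg _) hs0.ne']

/-! ### Hadamard's inequality for arbitrary absolute values. -/

theorem abs_det_le_of_isNonarchimedean {K ι : Type*} [Field K] [Fintype ι] [DecidableEq ι]
    (v : AbsoluteValue K ℝ) (hv : IsNonarchimedean v) (A : Matrix ι ι K) (b : ι → ℝ)
    (hA : ∀ i j, v (A i j) ≤ b i) : v A.det ≤ ∏ i, b i := by
  rw [← Matrix.det_transpose, Matrix.det_apply]
  obtain ⟨σ, -, hσ⟩ := hv.finset_image_add_of_nonempty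
    (fun σ : Equiv.Perm ι => Equiv.Perm.sign σ • ∏ i, A.transpose (σ i) i) Finset.univ_nonempty
  refine hσ.trans ?_
  have h1 : v (Equiv.Perm.sign σ • ∏ i, A.transpose (σ i) i) = ∏ i, v (A i (σ i)) := by
    rcases Int.units_eq_one_or (Equiv.Perm.sign σ) with h | h <;> simp [h, map_prod]
  rw [h1]
  exact Finset.prod_le_prod (fun i _ => v.nonneg _) fun i _ => hA i _

/-- **Hadamard's inequality** over a field with an arbitrary absolute value. -/
theorem abs_det_sq_le {K ι : Type*} [Field K] [Fintype ι] [DecidableEq ι]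
    (v : AbsoluteValue K ℝ) (A : Matrix ι ι K) (b : ι → ℝ) (hb : ∀ i, 0 < b i)
    (hA : ∀ i j, v (A i j) ≤ b i) :
    v A.det ^ 2 ≤ Real.exp (archEps v * Fintype.card ι * Real.log (Fintype.card ι)) *
      (∏ i, b i) ^ 2 := by
  by_cases hv : IsNonarchimedean v
  · rw [archEps, if_pos hv, zero_mul, zero_mul, Real.exp_zero, one_mul]
    exact pow_le_pow_left₀ (v.nonneg _) (abs_det_le_of_isNonarchimedean v hv A b hA) 2
  rw [archEps, if_neg hv, one_mul]
  rcases isEmpty_or_nonempty ι with hι | hι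
  · simp
  have hn : 0 < (Fintype.card ι : ℝ) := by exact_mod_cast Fintype.card_pos
  have hexp : Real.exp (Fintype.card ι * Real.log (Fintype.card ι)) =
      (Fintype.card ι : ℝ) ^ Fintype.card ι := by
    rw [mul_comm, Real.exp_mul, Real.exp_log hn, Real.rpow_natCast]
  rw [hexp]
  obtain ⟨s, hs0, hs1, σ, hσ⟩ := exists_ringHom_complex_rpow v hv
  -- The complex inequality is used with the bounds `b i ^ (1/s)` and then raised to the power `s`.
  -- The factor `n ^ n` can only shrink, as `s ≤ 1`.
  have h := norm_det_sq_le (σ.mapMatrix A) (fun i => b i ^ s⁻¹)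
    (fun i => Real.rpow_pos_of_pos (hb i) _) fun i j => by
      have h1 := hA i j
      rw [hσ] at h1
      have h2 := Real.rpow_le_rpow (by positivity) h1 (inv_nonneg.2 hs0.le)
      rwa [Real.rpow_rpow_inv (norm_nonneg _) hs0.ne'] at h2
  rw [← RingHom.map_det] at h
  have hP : 0 < ∏ i, b i := Finset.prod_pos fun i _ => hb i
  have hn1 : (1 : ℝ) ≤ (Fintype.card ι : ℝ) ^ Fintype.card ι :=
    one_le_pow₀ (by exact_mod_cast Fintype.card_pos)
  have h3 := Real.rpow_le_rpow (by positivity) h hs0.le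
  rw [Real.finsetProd_rpow _ _ (fun i _ => (hb i).le), Real.mul_rpow (by positivity) (by positivity),
    ← Real.rpow_pow_comm (norm_nonneg _), ← hσ,
    ← Real.rpow_pow_comm (by positivity : 0 ≤ (∏ i, b i) ^ s⁻¹), Real.rpow_inv_rpow hP.le hs0.ne'] at h3
  refine h3.trans ?_
  gcongr
  calc ((Fintype.card ι : ℝ) ^ Fintype.card ι) ^ s
      ≤ ((Fintype.card ι : ℝ) ^ Fintype.card ι) ^ (1 : ℝ) :=
        Real.rpow_le_rpow_of_exponent_le hn1 hs1
    _ = _ := Real.rpow_one _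

/-! ### Coefficient determinants of mixed products as powers of the resultant. -/

section Determinants

open Polynomial Matrix

variable {K : Type*} [Field K]

/-- Squaring removes the sign of the reindexing; this is why all later determinant identities are
stated for squares. -/
theorem det_submatrix_sq {m n R : Type*} [CommRing R] [Fintype m] [DecidableEq m] [Fintype n]
    [DecidableEq n] (A : Matrix m m R) (e₁ e₂ : n ≃ m) :
    (A.submatrix e₁ e₂).det ^ 2 = A.det ^ 2 := by
  have h : A.submatrix e₁ e₂ = (A.submatrix e₂ e₂).submatrix (e₁.trans e₂.symm) id := by
    ext i j; simp
  rw [h, Matrix.det_permute, Matrix.det_submatrix_equiv_self, mul_pow]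
  rcases Int.units_eq_one_or (Equiv.Perm.sign (e₁.trans e₂.symm)) with h | h <;> simp [h]

/-- The matrix whose columns are the first `N` coefficients of a family of polynomials. -/
def coeffMatrix (N : ℕ) {ι : Type*} (p : ι → K[X]) : Matrix (Fin N) ι K :=
  Matrix.of fun i j => (p j).coeff i

/-- The products `X^a f^k g^(M-1-k)` with `a < d` and `k < M`. -/
def mixedProducts (d : ℕ) (f g : K[X]) (M : ℕ) (ak : Fin d × Fin M) : K[X] :=
  X ^ (ak.1 : ℕ) * (f ^ (ak.2 : ℕ) * g ^ (ak.2.rev : ℕ))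

theorem natDegree_mixedProducts_lt {d : ℕ} {f g : K[X]} (hf : f.natDegree ≤ d)
    (hg : g.natDegree ≤ d) {M : ℕ} (ak : Fin d × Fin M) :
    (mixedProducts d f g M ak).natDegree < d * M := by
  obtain ⟨a, k⟩ := ak
  have h1 : (mixedProducts d f g M (a, k)).natDegree ≤
      (a : ℕ) + ((k : ℕ) * d + (k.rev : ℕ) * d) := by
    refine natDegree_mul_le_of_le (natDegree_X_pow_le _) (natDegree_mul_le_of_le ?_ ?_)
    · exact natDegree_pow_le_of_le _ hf
    · exact natDegree_pow_le_of_le _ hg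
  have h2 : (k : ℕ) + (k.rev : ℕ) + 1 = M := by
    rw [Fin.val_rev]; omega
  calc _ ≤ (a : ℕ) + ((k : ℕ) * d + (k.rev : ℕ) * d) := h1
    _ < d + ((k : ℕ) * d + (k.rev : ℕ) * d) := by gcongr; exact a.2
    _ = d * M := by linear_combination d * h2

theorem sylvester_castAdd (f : K[X]) {g : K[X]} {m n : ℕ} (hg : g.natDegree ≤ n)
    (i : Fin (m + n)) (j : Fin m) :
    sylvester f g m n i (Fin.castAdd n j) = (X ^ (j : ℕ) * g).coeff i := by
  rw [sylvester, Matrix.of_apply, Fin.addCases_left, coeff_X_pow_mul']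
  simp only [Set.mem_Icc]
  by_cases h1 : (j : ℕ) ≤ i
  · by_cases h2 : (i : ℕ) ≤ j + n
    · rw [if_pos ⟨h1, h2⟩, if_pos h1]
    · rw [if_neg (fun h => h2 h.2), if_pos h1, coeff_eq_zero_of_natDegree_lt (by omega)]
  · rw [if_neg (fun h => h1 h.1), if_neg h1]

theorem sylvester_natAdd {f : K[X]} (g : K[X]) {m n : ℕ} (hf : f.natDegree ≤ m)
    (i : Fin (m + n)) (j : Fin n) :
    sylvester f g m n i (Fin.natAdd m j) = (X ^ (j : ℕ) * f).coeff i := by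
  rw [sylvester, Matrix.of_apply, Fin.addCases_right, coeff_X_pow_mul']
  simp only [Set.mem_Icc]
  by_cases h1 : (j : ℕ) ≤ i
  · by_cases h2 : (i : ℕ) ≤ j + m
    · rw [if_pos ⟨h1, h2⟩, if_pos h1]
    · rw [if_neg (fun h => h2 h.2), if_pos h1, coeff_eq_zero_of_natDegree_lt (by omega)]
  · rw [if_neg (fun h => h1 h.1), if_neg h1]

/-- The formal degree `d` may exceed the degree of `g`. The excess contributes only powers of
`f.coeff d` to the resultant, which are compatible with taking `M`-th powers. -/
theorem resultant_pow_right_of_le {f g : K[X]} {d : ℕ} (hf : f.natDegree ≤ d)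
    (hg : g.natDegree ≤ d) (M : ℕ) :
    resultant f (g ^ M) d (d * M) = resultant f g d d ^ M := by
  rcases eq_or_ne g 0 with rfl | hg0
  · rcases eq_or_ne M 0 with rfl | hM
    · simp
    · rw [zero_pow hM, resultant_zero_right, resultant_zero_right, mul_pow, ← pow_mul, ← pow_mul]
      rcases eq_or_ne d 0 with rfl | hd
      · simp
      · rw [zero_pow hd, zero_pow (mul_ne_zero hd hM), zero_mul]
  obtain ⟨k, rfl⟩ := Nat.exists_eq_add_of_le hg
  have h1 : (g.natDegree + k) * M = (g ^ M).natDegree + k * M := by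
    rw [natDegree_pow]; ring
  rw [h1, resultant_add_right_deg _ _ _ _ _ le_rfl,
    resultant_add_right_deg _ _ _ _ _ le_rfl, resultant_pow_right _ _ _ _ hf
      (pow_ne_zero _ (leadingCoeff_ne_zero.2 hg0)), mul_pow, ← pow_mul]

/-- Induction on `M`. The family for `M + 1` consists of the `X ^ a * g ^ M` and of `f` times the
family for `M`, so its coefficient matrix is the Sylvester matrix of `f` and `g ^ M` times a block
matrix `diag(1, C)`. The new factor is `Res ^ (2 M)` after squaring, and `M (M - 1) + 2 M = (M + 1)
M`. -/
theorem det_coeffMatrix_mixedProducts_sq {d : ℕ} {f g : K[X]} (hf : f.natDegree ≤ d)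
    (hg : g.natDegree ≤ d) (M : ℕ) :
    ((coeffMatrix (d * M) (mixedProducts d f g M)).submatrix finProdFinEquiv id).det ^ 2 =
      resultant f g d d ^ (M * (M - 1)) := by
  induction M with
  | zero => simp
  | succ M ih =>
    set C := coeffMatrix (d * M) (mixedProducts d f g M) with hC
    let r : Fin (d + d * M) ≃ Fin (d * (M + 1)) := finCongr (by ring)
    let S : Matrix (Fin (d * (M + 1))) (Fin d ⊕ Fin (d * M)) K :=
      (sylvester f (g ^ M) d (d * M)).submatrix r.symm finSumFinEquiv
    let B : Matrix (Fin d ⊕ Fin (d * M)) (Fin d ⊕ Fin d × Fin M) K :=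
      Matrix.fromBlocks 1 0 0 C
    -- The index `k = 0` gives the products without a factor `f`; `k.succ` gives `f` times a product
    -- of the previous family.
    let q : Fin d ⊕ Fin d × Fin M ≃ Fin d × Fin (M + 1) :=
      { toFun := Sum.elim (fun a => (a, 0)) (fun x => (x.1, x.2.succ))
        invFun := fun x => Fin.cases (Sum.inl x.1) (fun k => Sum.inr (x.1, k)) x.2
        left_inv := by rintro (a | ⟨a, k⟩) <;> rfl
        right_inv := by
          rintro ⟨a, k⟩
          refine Fin.cases rfl (fun k => rfl) k }
    let w : Fin d × Fin M ≃ Fin (d * M) := finProdFinEquiv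
    have hgM : (g ^ M).natDegree ≤ d * M := by
      rw [mul_comm]; exact natDegree_pow_le_of_le _ hg
    have hmul : (coeffMatrix (d * (M + 1)) (mixedProducts d f g (M + 1))).submatrix id q =
        S * B := by
      ext i j
      rw [Matrix.mul_apply, Fintype.sum_sum_type]
      rcases j with a | ⟨a, k⟩
      · simp only [B, Matrix.fromBlocks_apply₁₁, Matrix.fromBlocks_apply₂₁, Matrix.zero_apply,
          mul_zero, Finset.sum_const_zero, add_zero, Matrix.one_apply, mul_ite, mul_one,
          Finset.sum_ite_eq', Finset.mem_univ, if_true]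
        show (mixedProducts d f g (M + 1) (a, 0)).coeff i =
          sylvester f (g ^ M) d (d * M) (r.symm i) (Fin.castAdd _ a)
        rw [sylvester_castAdd _ hgM]
        simp [mixedProducts, r]
      · simp only [B, Matrix.fromBlocks_apply₁₂, Matrix.fromBlocks_apply₂₂, Matrix.zero_apply,
          mul_zero, Finset.sum_const_zero, zero_add]
        have h1 : ∀ j : Fin (d * M), S i (Sum.inr j) = (X ^ (j : ℕ) * f).coeff i := fun j => by
          show sylvester f (g ^ M) d (d * M) (r.symm i) (Fin.natAdd _ j) = _
          rw [sylvester_natAdd _ hf]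
          rfl
        simp only [h1]
        show (mixedProducts d f g (M + 1) (a, k.succ)).coeff i = _
        have h2 : mixedProducts d f g (M + 1) (a, k.succ) = mixedProducts d f g M (a, k) * f := by
          have : (k.succ.rev : ℕ) = k.rev := by simp [Fin.val_rev]
          simp only [mixedProducts, this, Fin.val_succ]
          ring
        have h3 := (mixedProducts d f g M (a, k)).as_sum_range'
          (d * M) (natDegree_mixedProducts_lt hf hg _)
        rw [h2]
        conv_lhs => rw [h3, Finset.sum_mul, finsetSum_coeff]
        rw [Finset.sum_range]
        refine Finset.sum_congr rfl fun j _ => ?_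
        rw [← C_mul_X_pow_eq_monomial, mul_assoc, coeff_C_mul, mul_comm]
        rfl
    let e : Fin d × Fin (M + 1) ≃ Fin (d * (M + 1)) := finProdFinEquiv
    let u : Fin d × Fin (M + 1) ≃ Fin d ⊕ Fin (d * M) :=
      q.symm.trans ((Equiv.refl _).sumCongr w)
    have h1 : (coeffMatrix (d * (M + 1)) (mixedProducts d f g (M + 1))).submatrix e id =
        S.submatrix e u * B.submatrix u q.symm := by
      rw [Matrix.submatrix_mul_equiv, ← hmul]
      ext i j
      simp
    have h2 : (B.submatrix u q.symm).det = (C.submatrix w id).det := by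
      have : B.submatrix u q.symm =
          (Matrix.fromBlocks 1 0 0 (C.submatrix w id)).submatrix q.symm q.symm := by
        ext i j
        simp only [Matrix.submatrix_apply, u, Equiv.trans_apply]
        rcases q.symm i with a | x <;> rcases q.symm j with b | y <;> rfl
      rw [this, Matrix.det_submatrix_equiv_self, Matrix.det_fromBlocks_zero₁₂, Matrix.det_one,
        one_mul]
    have h3 : (S.submatrix e u).det ^ 2 = resultant f g d d ^ (2 * M) := by
      have : S.submatrix e u = (sylvester f (g ^ M) d (d * M)).submatrix (e.trans r.symm)
          (u.trans finSumFinEquiv) := by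
        ext i j; rfl
      rw [this, det_submatrix_sq, ← resultant, resultant_pow_right_of_le hf hg, ← pow_mul,
        mul_comm]
    show ((coeffMatrix (d * (M + 1)) (mixedProducts d f g (M + 1))).submatrix e id).det ^ 2 = _
    rw [h1, Matrix.det_mul, mul_pow, h2, h3, ih, ← pow_add]
    congr 1
    rcases M with _ | M
    · rfl
    · simp only [Nat.add_sub_cancel]; ring

/-- The monomials `z₀^i z₁^(N-1-i)`. -/
def monomials (N : ℕ) (z : Fin 2 → K) (i : Fin N) : K := z 0 ^ (i : ℕ) * z 1 ^ (i.rev : ℕ)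

theorem monomials_dotProduct_coeff {N : ℕ} (hN : 0 < N) (p : K[X]) (z : Fin 2 → K) :
    monomials N z ⬝ᵥ (fun i => p.coeff i) = MvPolynomial.eval z (p.homogenize (N - 1)) := by
  obtain ⟨n, rfl⟩ := Nat.exists_eq_succ_of_ne_zero hN.ne'
  rw [homogenize, MvPolynomial.eval_sum, Finset.Nat.sum_antidiagonal_eq_sum_range_succ_mk,
    dotProduct]
  simp only [Nat.succ_eq_add_one, Nat.add_sub_cancel]
  rw [Finset.sum_range]
  refine Finset.sum_congr rfl fun i _ => ?_
  rw [MvPolynomial.eval_monomial, Finsupp.update_eq_add_single (by simp),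
    Finsupp.prod_add_index' (by simp) (by simp [pow_add])]
  simp [monomials, Fin.val_rev, mul_comm]

theorem homogenize_pow {f : K[X]} {d : ℕ} (hf : f.natDegree ≤ d) (k : ℕ) :
    (f ^ k).homogenize (k * d) = f.homogenize d ^ k := by
  have := homogenize_finsetProd (s := Finset.range k) (p := fun _ => f) (n := fun _ => d)
    (fun _ _ => hf)
  simpa using this

/-- Homogenization is multiplicative in formal degrees, and `(d - 1) + (M - 1) d = d M - 1`. This
identity passes from degree `M - 1` at the image point to degree `d M - 1` at `z`, and drives the
recursion for the adapted basis. -/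
theorem monomials_vecMul_mixedProducts {d : ℕ} {f g : K[X]} (hf : f.natDegree ≤ d)
    (hg : g.natDegree ≤ d) (M : ℕ) (z : Fin 2 → K) :
    monomials (d * M) z ᵥ* coeffMatrix (d * M) (mixedProducts d f g M) = fun ak =>
      monomials d z ak.1 * monomials M ![MvPolynomial.eval z (f.homogenize d),
        MvPolynomial.eval z (g.homogenize d)] ak.2 := by
  ext ⟨a, k⟩
  have ha := a.2
  have hk := k.2
  have hN : 0 < d * M := Nat.mul_pos (by omega) (by omega)
  have h2 : (k : ℕ) + (k.rev : ℕ) + 1 = M := by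
    rw [Fin.val_rev]; omega
  have h1 : d * M - 1 = (d - 1) + ((k : ℕ) * d + (k.rev : ℕ) * d) := by
    have : d * M = d + ((k : ℕ) * d + (k.rev : ℕ) * d) := by linear_combination (d : ℕ) * h2.symm
    omega
  refine (monomials_dotProduct_coeff hN (mixedProducts d f g M (a, k)) z).trans ?_
  have hfk : (f ^ (k : ℕ)).natDegree ≤ (k : ℕ) * d := natDegree_pow_le_of_le _ hf
  have hgk : (g ^ (k.rev : ℕ)).natDegree ≤ (k.rev : ℕ) * d := natDegree_pow_le_of_le _ hg
  rw [mixedProducts, h1, homogenize_mul _ _ ((natDegree_X_pow_le _).trans (by simp; omega))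
    (natDegree_mul_le_of_le hfk hgk), homogenize_mul _ _ hfk hgk, homogenize_pow hf,
    homogenize_pow hg, homogenize_X_pow (by simp; omega)]
  have h3 : d - 1 - (a : ℕ) = d - (a + 1) := by omega
  simp [monomials, Fin.val_rev, h3]

end Determinants

/-! ### Upper and lower bounds for the norm of the image of a vector. -/

section Norms

open Polynomial Matrix

variable {K : Type*} [Field K]

theorem supNorm_nonneg (v : AbsoluteValue K ℝ) (z : Fin 2 → K) : 0 ≤ supNorm v z :=
  (v.nonneg _).trans (le_max_left _ _)

theorem le_supNorm (v : AbsoluteValue K ℝ) (z : Fin 2 → K) (i : Fin 2) : v (z i) ≤ supNorm v z := by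
  fin_cases i
  · exact le_max_left _ _
  · exact le_max_right _ _

theorem supNorm_le {v : AbsoluteValue K ℝ} {z : Fin 2 → K} {r : ℝ} (h : ∀ i, v (z i) ≤ r) :
    supNorm v z ≤ r := max_le (h 0) (h 1)

theorem supNorm_pos (v : AbsoluteValue K ℝ) {z : Fin 2 → K} (hz : z ≠ 0) : 0 < supNorm v z := by
  obtain ⟨i, hi⟩ := Function.ne_iff.1 hz
  exact (v.pos hi).trans_le (le_supNorm v z i)

theorem supNorm_smul (v : AbsoluteValue K ℝ) (c : K) (z : Fin 2 → K) :
    supNorm v (c • z) = v c * supNorm v z := by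
  simp only [supNorm, Pi.smul_apply, smul_eq_mul, map_mul]
  rw [mul_max_of_nonneg _ _ (v.nonneg c)]

theorem abs_monomials_le (v : AbsoluteValue K ℝ) (N : ℕ) (z : Fin 2 → K) (i : Fin N) :
    v (monomials N z i) ≤ supNorm v z ^ (N - 1) := by
  have h : N - 1 = (i : ℕ) + (i.rev : ℕ) := by
    have := i.2
    rw [Fin.val_rev]; omega
  rw [monomials, map_mul, map_pow, map_pow, h, pow_add]
  gcongr
  · exact pow_nonneg (supNorm_nonneg v z) _
  · exact le_supNorm v z 0
  · exact le_supNorm v z 1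

theorem abs_dotProduct_le (v : AbsoluteValue K ℝ) {ι : Type*} [Fintype ι] (x y : ι → K) {r : ℝ}
    (h : ∀ i, v (x i) ≤ r) : v (x ⬝ᵥ y) ≤ (∑ i, v (y i)) * r := by
  rw [dotProduct, Finset.sum_mul]
  refine (v.sum_le _ _).trans (Finset.sum_le_sum fun i _ => ?_)
  rw [map_mul, mul_comm]
  gcongr
  exact h i

/-- The self-map of `K²` given by the degree `d` homogenizations of two polynomials. -/
def pairMap (d : ℕ) (f g : K[X]) (z : Fin 2 → K) : Fin 2 → K :=
  ![MvPolynomial.eval z (f.homogenize d), MvPolynomial.eval z (g.homogenize d)]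

theorem exists_supNorm_pairMap_le (v : AbsoluteValue K ℝ) (d : ℕ) (f g : K[X]) :
    ∃ A : ℝ, 0 < A ∧ ∀ z, supNorm v (pairMap d f g z) ≤ A * supNorm v z ^ d := by
  have h : ∀ (p : K[X]) z, v (MvPolynomial.eval z (p.homogenize d)) ≤
      (∑ i : Fin (d + 1), v (p.coeff i)) * supNorm v z ^ d := fun p z => by
    have := monomials_dotProduct_coeff d.succ_pos p z
    rw [Nat.succ_eq_add_one, Nat.add_sub_cancel] at this
    rw [← this]
    exact abs_dotProduct_le v _ _ fun i => abs_monomials_le v (d + 1) z i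
  have h0 : ∀ p : K[X], 0 ≤ ∑ i : Fin (d + 1), v (p.coeff i) := fun p =>
    Finset.sum_nonneg fun i _ => v.nonneg _
  refine ⟨(∑ i : Fin (d + 1), v (f.coeff i)) + (∑ i : Fin (d + 1), v (g.coeff i)) + 1,
    by linarith [h0 f, h0 g], fun z => supNorm_le fun i => ?_⟩
  have hz := pow_nonneg (supNorm_nonneg v z) d
  fin_cases i
  · refine (h f z).trans (mul_le_mul_of_nonneg_right ?_ hz)
    linarith [h0 f, h0 g]
  · refine (h g z).trans (mul_le_mul_of_nonneg_right ?_ hz)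
    linarith [h0 f, h0 g]

/-- An effective Nullstellensatz: for `M = 2` the mixed products form a basis since the resultant is
nonzero. Monomials of degree `2 d - 1` are therefore combinations of monomials of degree `d - 1`
times the two forms, whence `‖z‖ ^ (2 d - 1) ≤ B ‖z‖ ^ (d - 1) ‖F(z)‖`. -/
theorem exists_supNorm_pow_le_pairMap (v : AbsoluteValue K ℝ) {d : ℕ} (hd : 0 < d) {f g : K[X]}
    (hf : f.natDegree ≤ d) (hg : g.natDegree ≤ d) (hR : resultant f g d d ≠ 0) :
    ∃ B : ℝ, 0 < B ∧ ∀ z, supNorm v z ^ d ≤ B * supNorm v (pairMap d f g z) := by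
  set C := coeffMatrix (d * 2) (mixedProducts d f g 2) with hC
  let w : Fin d × Fin 2 ≃ Fin (d * 2) := finProdFinEquiv
  set A := C.submatrix w id with hA
  have hdet : IsUnit A.det := by
    refine isUnit_iff_ne_zero.2 fun h => ?_
    have := det_coeffMatrix_mixedProducts_sq hf hg 2
    rw [show ((coeffMatrix (d * 2) (mixedProducts d f g 2)).submatrix finProdFinEquiv id).det = 0
      from h] at this
    exact pow_ne_zero _ hR (this.symm.trans (by norm_num))
  have h0 : ∀ j, 0 ≤ ∑ i, v (A⁻¹ i j) := fun j => Finset.sum_nonneg fun i _ => v.nonneg _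
  set B := ∑ j, ∑ i, v (A⁻¹ i j) with hB
  have hB0 : 0 ≤ B := Finset.sum_nonneg fun j _ => h0 j
  refine ⟨B + 1, by linarith, fun z => ?_⟩
  have hs0 := supNorm_nonneg v z
  have hS0 := supNorm_nonneg v (pairMap d f g z)
  rcases hs0.eq_or_lt with hs | hs
  · rw [← hs, zero_pow hd.ne']; positivity
  set s := supNorm v z with hsdef
  set S := supNorm v (pairMap d f g z) with hS
  set u : Fin d × Fin 2 → K := fun ak => monomials d z ak.1 * monomials 2 (pairMap d f g z) ak.2
    with hu
  have h1 : (fun j => monomials (d * 2) z (w j)) ᵥ* A = u := by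
    have h2 := monomials_vecMul_mixedProducts hf hg 2 z
    rw [← hC] at h2
    refine Eq.trans ?_ h2
    ext j
    exact Equiv.sum_comp w fun i => monomials (d * 2) z i * C i j
  have h3 : u ᵥ* A⁻¹ = fun j => monomials (d * 2) z (w j) := by
    rw [← h1, Matrix.vecMul_vecMul, Matrix.mul_nonsing_inv _ hdet, Matrix.vecMul_one]
  have h4 : ∀ i, v (monomials (d * 2) z i) ≤ B * (s ^ (d - 1) * S) := fun i => by
    have h5 := congrFun h3 (w.symm i)
    simp only [Equiv.apply_symm_apply] at h5
    rw [← h5]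
    refine (abs_dotProduct_le v u (fun j => A⁻¹ j (w.symm i)) (r := s ^ (d - 1) * S)
      fun ak => ?_).trans ?_
    · rw [hu, map_mul]
      gcongr
      · exact abs_monomials_le v d z _
      · exact (abs_monomials_le v 2 _ _).trans (by simp [hS])
    · refine mul_le_mul_of_nonneg_right ?_ (by positivity)
      exact Finset.single_le_sum (f := fun j => ∑ i, v (A⁻¹ i j)) (fun j _ => h0 j)
        (Finset.mem_univ _)
  have h6 : s ^ (2 * d - 1) ≤ B * (s ^ (d - 1) * S) := by
    -- The two extreme monomials are the pure powers of the coordinates; one of them realizes `‖z‖ ^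
    -- (2 d - 1)`.
    have e0 := h4 ⟨d * 2 - 1, by omega⟩
    have e1 := h4 ⟨0, by omega⟩
    have n1 : d * 2 - (d * 2 - 1 + 1) = 0 := by omega
    simp only [monomials, Fin.val_rev, n1, pow_zero, mul_one, one_mul, zero_add, map_pow] at e0 e1
    rw [mul_comm d 2] at e0 e1
    rcases max_cases (v (z 0)) (v (z 1)) with ⟨h, -⟩ | ⟨h, -⟩
    · exact (congrArg (· ^ (2 * d - 1)) h).le.trans e0
    · exact (congrArg (· ^ (2 * d - 1)) h).le.trans e1
  have h7 : s ^ (2 * d - 1) = s ^ (d - 1) * s ^ d := by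
    rw [← pow_add]; congr 1; omega
  rw [h7, mul_left_comm] at h6
  have h8 : s ^ d ≤ B * S := le_of_mul_le_mul_left h6 (by positivity)
  linarith

end Norms

/-! ### Nonvanishing of the homogeneous resultant. -/

section Resultant

open Polynomial

variable {K : Type*} [Field K]

/-- The dehomogenization `p(X, 1)` of a binary form. -/
def dehom (p : MvPolynomial (Fin 2) K) : K[X] := MvPolynomial.aeval ![(X : K[X]), 1] p

theorem natDegree_dehom_le {d : ℕ} {p : MvPolynomial (Fin 2) K} (hp : p.IsHomogeneous d) :
    (dehom p).natDegree ≤ d := by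
  rw [dehom, p.as_sum, map_sum]
  refine natDegree_sum_le_of_forall_le _ _ fun m hm => ?_
  have h1 : m 0 + m 1 = d := by
    have := hp (MvPolynomial.mem_support_iff.1 hm)
    simpa [Finsupp.weight_apply, Finsupp.sum_fintype] using this
  rw [MvPolynomial.aeval_monomial, Finsupp.prod_fintype _ _ (by simp)]
  simp only [Fin.prod_univ_two, Matrix.cons_val_zero, Matrix.cons_val_one, one_pow, mul_one,
    ← C_eq_algebraMap]
  exact (natDegree_C_mul_X_pow_le _ _).trans (by omega)

theorem homogenize_dehom {d : ℕ} {p : MvPolynomial (Fin 2) K} (hp : p.IsHomogeneous d) :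
    (dehom p).homogenize d = p :=
  homogenize_eq_of_isHomogeneous hp rfl

theorem X_one_dvd_homogenize {f : K[X]} {d : ℕ} (hf : f.natDegree < d) :
    MvPolynomial.X 1 ∣ f.homogenize d := by
  have h := homogenize_mul f 1 (m := d - 1) (n := 1) (by omega) (by simp)
  rw [mul_one, homogenize_one, pow_one, Nat.sub_add_cancel (by omega)] at h
  exact ⟨_, h.trans (mul_comm _ _)⟩

theorem X_sub_dvd_homogenize {f : K[X]} {d : ℕ} (hd : 0 < d) (hf : f.natDegree ≤ d) {a : K}
    (ha : f.IsRoot a) :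
    MvPolynomial.C 1 * MvPolynomial.X 0 + MvPolynomial.C (-a) * MvPolynomial.X 1 ∣
      f.homogenize d := by
  obtain ⟨q, rfl⟩ := dvd_iff_isRoot.2 ha
  rcases eq_or_ne q 0 with rfl | hq
  · simp
  rw [natDegree_mul (X_sub_C_ne_zero a) hq, natDegree_X_sub_C] at hf
  have h := homogenize_mul (X - C a) q (m := 1) (n := d - 1) (by simp) (by omega)
  rw [Nat.add_sub_cancel' (by omega)] at h
  rw [h]
  refine Dvd.intro _ (congrArg (· * _) ?_)
  rw [homogenize_sub, homogenize_X one_ne_zero, homogenize_C]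
  simp [sub_eq_add_neg]

/-- If one polynomial attains the formal degree, the formal resultant differs from the usual one by
a nonzero factor, so it still detects coprimality. If both degrees drop it vanishes for another
reason: a common zero at infinity. -/
theorem isCoprime_of_resultant_eq_zero {f g : K[X]} {d : ℕ} (hf : f.natDegree ≤ d)
    (hg : g.natDegree = d) (hd : 0 < d) (h : resultant f g d d = 0) : ¬ IsCoprime f g := by
  intro hc
  obtain ⟨k, rfl⟩ := Nat.exists_eq_add_of_le hf
  rw [resultant_add_left_deg _ _ _ _ _ le_rfl] at h
  have h1 : g.coeff (f.natDegree + k) ≠ 0 := by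
    rw [← hg, coeff_natDegree, leadingCoeff_ne_zero]
    rintro rfl
    rw [natDegree_zero] at hg
    omega
  rw [← hg] at h
  rw [← hg] at h1
  refine resultant_ne_zero f g hc ?_
  rcases mul_eq_zero.1 h with h2 | h2
  · exfalso
    rcases mul_eq_zero.1 h2 with h3 | h3
    · exact pow_ne_zero _ (by norm_num) h3
    · exact pow_ne_zero _ h1 h3
  · exact h2

/-- A vanishing resultant means over the algebraic closure either that both degrees drop, so that
`y` divides both forms, or that there is a common root `a`, so that `x - a y` does. -/
theorem IsLift.homResultant_ne_zero {d : ℕ} (hd : 0 < d) {F : Fin 2 → MvPolynomial (Fin 2) K}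
    (hF : IsLift d F) : homResultant d F ≠ 0 := by
  intro h0
  set φ := algebraMap K (AlgebraicClosure K)
  have hdeg : ∀ i, ((dehom (F i)).map φ).natDegree ≤ d := fun i =>
    (natDegree_map_le).trans (natDegree_dehom_le (hF.homogeneous i))
  have hhom : ∀ i, MvPolynomial.map φ (F i) = ((dehom (F i)).map φ).homogenize d := fun i => by
    rw [homogenize_map, homogenize_dehom (hF.homogeneous i)]
  have hres : resultant ((dehom (F 0)).map φ) ((dehom (F 1)).map φ) d d = 0 := by
    rw [resultant_map_map]
    exact (congrArg φ h0).trans (map_zero _)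
  have hnc : ((dehom (F 0)).map φ).natDegree < d ∧ ((dehom (F 1)).map φ).natDegree < d ∨
      ¬ IsCoprime ((dehom (F 0)).map φ) ((dehom (F 1)).map φ) := by
    rcases (hdeg 1).eq_or_lt with h1 | h1
    · exact Or.inr (isCoprime_of_resultant_eq_zero (hdeg 0) h1 hd hres)
    rcases (hdeg 0).eq_or_lt with h2 | h2
    · refine Or.inr fun hc => isCoprime_of_resultant_eq_zero (hdeg 1) h2 hd ?_ hc.symm
      rw [resultant_comm, hres, mul_zero]
    · exact Or.inl ⟨h2, h1⟩
  rcases hnc with ⟨h1, h2⟩ | hnc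
  · refine hF.no_common_factor 0 1 (Or.inr one_ne_zero) fun i => ?_
    rw [hhom]
    simp only [map_zero, map_one, zero_mul, one_mul, zero_add]
    fin_cases i
    · exact X_one_dvd_homogenize h1
    · exact X_one_dvd_homogenize h2
  · rw [isCoprime_iff_aeval_ne_zero_of_isAlgClosed _ (AlgebraicClosure K)] at hnc
    push Not at hnc
    obtain ⟨a, ha0, ha1⟩ := hnc
    refine hF.no_common_factor 1 (-a) (Or.inl one_ne_zero) fun i => ?_
    rw [hhom]
    refine X_sub_dvd_homogenize hd (hdeg i) ?_
    fin_cases i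
    · simpa using ha0
    · simpa using ha1

theorem polyMap_eq_pairMap {L : Type*} [Field L] [Algebra K L] {d : ℕ}
    {F : Fin 2 → MvPolynomial (Fin 2) K} (hF : ∀ i, (F i).IsHomogeneous d) (z : Fin 2 → L) :
    polyMap L F z = pairMap d ((dehom (F 0)).map (algebraMap K L))
      ((dehom (F 1)).map (algebraMap K L)) z := by
  ext i
  have h : ∀ i, MvPolynomial.aeval z (F i) = MvPolynomial.eval z
      (((dehom (F i)).map (algebraMap K L)).homogenize d) := fun i => by
    rw [homogenize_map, homogenize_dehom (hF i), MvPolynomial.eval_map, MvPolynomial.aeval_def]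
  fin_cases i
  · exact h 0
  · exact h 1

theorem exists_supNorm_polyMap_bounds {L : Type*} [Field L] [Algebra K L] (w : AbsoluteValue L ℝ)
    {d : ℕ} (hd : 0 < d) {F : Fin 2 → MvPolynomial (Fin 2) K} (hF : IsLift d F) :
    ∃ A : ℝ, 0 < A ∧ ∃ B : ℝ, 0 < B ∧ ∀ z : Fin 2 → L,
      supNorm w (polyMap L F z) ≤ A * supNorm w z ^ d ∧
      supNorm w z ^ d ≤ B * supNorm w (polyMap L F z) := by
  have hdeg : ∀ i, ((dehom (F i)).map (algebraMap K L)).natDegree ≤ d := fun i =>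
    (natDegree_map_le).trans (natDegree_dehom_le (hF.homogeneous i))
  obtain ⟨A, hA, h1⟩ := exists_supNorm_pairMap_le w d ((dehom (F 0)).map (algebraMap K L))
    ((dehom (F 1)).map (algebraMap K L))
  obtain ⟨B, hB, h2⟩ := exists_supNorm_pow_le_pairMap w hd (hdeg 0) (hdeg 1) (by
    rw [resultant_map_map]
    exact (_root_.map_ne_zero _).2 (hF.homResultant_ne_zero hd))
  refine ⟨A, hA, B, hB, fun z => ?_⟩
  rw [polyMap_eq_pairMap hF.homogeneous]
  exact ⟨h1 z, h2 z⟩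

end Resultant

/-! ### Iteration and the local height. -/

section Dynamics

variable {K : Type*} [Field K] {d : ℕ} {F : Fin 2 → MvPolynomial (Fin 2) K}

theorem polyMap_smul {L : Type*} [Field L] [Algebra K L] (hF : ∀ i, (F i).IsHomogeneous d)
    (c : L) (z : Fin 2 → L) : polyMap L F (c • z) = c ^ d • polyMap L F z := by
  ext i
  simp only [polyMap, Pi.smul_apply, smul_eq_mul, MvPolynomial.aeval_eq_eval₂Hom,
    MvPolynomial.coe_eval₂Hom, MvPolynomial.eval₂_eq, Finset.mul_sum]
  refine Finset.sum_congr rfl fun m hm => ?_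
  rw [(hF i).degree_eq_sum_deg_support hm, ← Finset.prod_pow_eq_pow_sum, mul_left_comm,
    ← Finset.prod_mul_distrib]
  simp only [mul_pow]

theorem iterate_polyMap_smul {L : Type*} [Field L] [Algebra K L]
    (hF : ∀ i, (F i).IsHomogeneous d) (c : L) (z : Fin 2 → L) (n : ℕ) :
    (polyMap L F)^[n] (c • z) = c ^ d ^ n • (polyMap L F)^[n] z := by
  induction n with
  | zero => simp
  | succ n ih =>
    rw [Function.iterate_succ_apply', ih, polyMap_smul hF, ← Function.iterate_succ_apply' (polyMap L F),
      ← pow_mul, pow_succ]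

theorem iterate_polyMap_algebraMap {L : Type*} [Field L] [Algebra K L] (z : Fin 2 → K) (n : ℕ) :
    (polyMap L F)^[n] (algebraMap K L ∘ z) = algebraMap K L ∘ (polyMap K F)^[n] z := by
  induction n with
  | zero => rfl
  | succ n ih =>
    rw [Function.iterate_succ_apply', ih, Function.iterate_succ_apply']
    ext i
    exact MvPolynomial.aeval_algebraMap_apply L _ (F i)

theorem IsLift.polyMap_ne_zero (hF : IsLift d F) (hd : 0 < d) {z : Fin 2 → K} (hz : z ≠ 0) :
    polyMap K F z ≠ 0 := by
  classical
  intro h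
  -- The lower bound for `‖F(z)‖`, read with the trivial absolute value, is a purely algebraic
  -- statement about zeros.
  let v : AbsoluteValue K ℝ := AbsoluteValue.trivial
  obtain ⟨A, -, B, -, hAB⟩ := exists_supNorm_polyMap_bounds v hd hF
  have h1 := (hAB z).2
  have h2 : supNorm v (0 : Fin 2 → K) = 0 := by simp [supNorm]
  rw [h, h2, mul_zero] at h1
  exact absurd h1 (not_le.2 (pow_pos (supNorm_pos v hz) d))

theorem IsLift.iterate_polyMap_ne_zero (hF : IsLift d F) (hd : 0 < d) {z : Fin 2 → K} (hz : z ≠ 0)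
    (n : ℕ) : (polyMap K F)^[n] z ≠ 0 := by
  induction n with
  | zero => exact hz
  | succ n ih =>
    rw [Function.iterate_succ_apply']
    exact hF.polyMap_ne_zero hd ih

/-- Tate's telescoping argument: `log ‖F(z)‖ - d log ‖z‖` is bounded, so consecutive terms differ by
`O(d⁻ⁿ)`, uniformly in `z`. -/
theorem exists_tendsto_localHeight (v : AbsoluteValue K ℝ) (hd : 2 ≤ d) (hF : IsLift d F) :
    ∃ C : ℝ, ∀ z : Fin 2 → K, z ≠ 0 →
      Tendsto (fun n : ℕ => (1 / (d : ℝ) ^ n) * Real.log (supNorm v ((polyMap K F)^[n] z))) atTop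
        (𝓝 (localHeight v d F z)) ∧ |Real.log (supNorm v z) - localHeight v d F z| ≤ C := by
  obtain ⟨A, hA, B, hB, hAB⟩ := exists_supNorm_polyMap_bounds v (by omega) hF
  have hd0 : (0 : ℝ) < d := by exact_mod_cast (by omega : 0 < d)
  have hd1 : 1 / (d : ℝ) < 1 := by
    rw [div_lt_one hd0]; exact_mod_cast (by omega : 1 < d)
  set D := max |Real.log A| |Real.log B| with hD
  have hstep : ∀ z : Fin 2 → K, z ≠ 0 →
      |Real.log (supNorm v (polyMap K F z)) - d * Real.log (supNorm v z)| ≤ D := fun z hz => by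
    have hz0 := supNorm_pos v hz
    have hFz0 := supNorm_pos v (hF.polyMap_ne_zero (by omega) hz)
    have h1 := Real.log_le_log hFz0 (hAB z).1
    have h2 := Real.log_le_log (pow_pos hz0 d) (hAB z).2
    rw [Real.log_mul hA.ne' (pow_pos hz0 d).ne', Real.log_pow] at h1
    rw [Real.log_mul hB.ne' hFz0.ne', Real.log_pow] at h2
    have h3 : Real.log A ≤ D := (le_abs_self _).trans (le_max_left _ _)
    have h4 : Real.log B ≤ D := (le_abs_self _).trans (le_max_right _ _)
    rw [abs_le]
    constructor <;> linarith
  refine ⟨D / (1 - 1 / (d : ℝ)), fun z hz => ?_⟩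
  set a : ℕ → ℝ := fun n => (1 / (d : ℝ) ^ n) * Real.log (supNorm v ((polyMap K F)^[n] z)) with ha
  have hdist : ∀ n, dist (a n) (a (n + 1)) ≤ D * (1 / (d : ℝ)) ^ n := fun n => by
    have h1 := hstep _ (hF.iterate_polyMap_ne_zero (by omega) hz n)
    rw [← Function.iterate_succ_apply' (polyMap K F)] at h1
    have h2 : a (n + 1) - a n = (1 / (d : ℝ) ^ (n + 1)) *
        (Real.log (supNorm v ((polyMap K F)^[n + 1] z)) -
          d * Real.log (supNorm v ((polyMap K F)^[n] z))) := by
      simp only [ha]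
      field_simp
      ring
    rw [dist_comm, Real.dist_eq, h2, abs_mul, abs_of_pos (by positivity), mul_comm, one_div_pow]
    have h3 : 1 / (d : ℝ) ^ (n + 1) ≤ 1 / (d : ℝ) ^ n := by
      refine one_div_le_one_div_of_le (by positivity) ?_
      exact pow_le_pow_right₀ (by exact_mod_cast (by omega : 1 ≤ d)) (Nat.le_succ n)
    exact mul_le_mul h1 h3 (by positivity) ((abs_nonneg _).trans h1)
  have hlim : Tendsto a atTop (𝓝 (localHeight v d F z)) :=
    tendsto_nhds_limUnder (cauchySeq_tendsto_of_complete
      (cauchySeq_of_le_geometric (1 / (d : ℝ)) D hd1 hdist))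
  refine ⟨hlim, ?_⟩
  have h := dist_le_of_le_geometric_of_tendsto₀ (1 / (d : ℝ)) D hd1 hdist hlim
  simpa [ha, Real.dist_eq] using h

theorem localHeight_polyMap (v : AbsoluteValue K ℝ) (hd : 2 ≤ d) (hF : IsLift d F)
    {z : Fin 2 → K} (hz : z ≠ 0) :
    localHeight v d F (polyMap K F z) = d * localHeight v d F z := by
  obtain ⟨C, hC⟩ := exists_tendsto_localHeight v hd hF
  have hd0 : (d : ℝ) ≠ 0 := by exact_mod_cast (by omega : d ≠ 0)
  have h1 := (hC _ (hF.polyMap_ne_zero (by omega) hz)).1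
  have h2 := ((tendsto_add_atTop_iff_nat 1).2 (hC z hz).1).const_mul (d : ℝ)
  refine tendsto_nhds_unique h1 (h2.congr fun n => ?_)
  rw [Function.iterate_succ_apply]
  field_simp
  ring

end Dynamics

/-! ### The adapted basis and the lower bound for distinct points. -/

section LowerBound

open Polynomial Matrix

variable {K : Type*} [Field K]

/-- A basis of the forms of degree `t d^k - 1` adapted to the iterates of `(f, g)`: the
coefficient matrix has resultant power determinant and the forms are small where `G` is. -/
theorem exists_adapted_basis (v : AbsoluteValue K ℝ) {d : ℕ} {f g : K[X]}
    (hf : f.natDegree ≤ d) (hg : g.natDegree ≤ d) {G : (Fin 2 → K) → ℝ} {C : ℝ}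
    (hG : ∀ z, z ≠ 0 → supNorm v z ≤ Real.exp (G z + C))
    (hΦ : ∀ z, z ≠ 0 → pairMap d f g z ≠ 0 ∧ G (pairMap d f g z) = d * G z) (t k N : ℕ)
    (hN : N = t * d ^ k) :
    ∃ (H : Matrix (Fin N) (Fin N) K) (E : ℕ), H.det ^ 2 = resultant f g d d ^ E ∧
      (E : ℝ) * (d * (d - 1)) = N * (N - 1 - (t - 1 + (d - 1) * k)) ∧
      ∀ z, z ≠ 0 → ∀ j, v ((monomials N z ᵥ* H) j) ≤
        Real.exp ((N - 1) * G z + (t - 1 + (d - 1) * k) * C) := by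
  have hmon : ∀ (n : ℕ) (z : Fin 2 → K) (_ : z ≠ 0) (i : Fin n),
      v (monomials n z i) ≤ Real.exp ((n - 1) * (G z + C)) := fun n z hz i => by
    refine (abs_monomials_le v n z i).trans ?_
    have hn : 1 ≤ n := by have := i.2; omega
    calc supNorm v z ^ (n - 1) ≤ Real.exp (G z + C) ^ (n - 1) :=
          pow_le_pow_left₀ (supNorm_nonneg v z) (hG z hz) _
      _ = _ := by rw [← Real.exp_nat_mul, Nat.cast_sub hn, Nat.cast_one]
  induction k generalizing N with
  | zero =>
    rw [pow_zero, mul_one] at hN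
    subst hN
    refine ⟨1, 0, by simp, by simp, fun z hz j => ?_⟩
    rw [Matrix.vecMul_one]
    refine (hmon N z hz j).trans (Real.exp_le_exp.2 (le_of_eq ?_))
    push_cast
    ring
  | succ k ih =>
    obtain ⟨M, hM⟩ : ∃ M, M = t * d ^ k := ⟨_, rfl⟩
    obtain ⟨H, E, hdet, hE, hH⟩ := ih M hM
    obtain rfl : N = d * M := by rw [hN, hM]; ring
    set P := coeffMatrix (d * M) (mixedProducts d f g M) with hP
    let B : Matrix (Fin d × Fin M) (Fin d × Fin M) K := Matrix.kroneckerMap (· * ·) 1 H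
    let w : Fin d × Fin M ≃ Fin (d * M) := finProdFinEquiv
    -- The new forms are a monomial of degree `d - 1` at `z` times an old form at the image of `z`.
    -- The block matrix `1 ⊗ H` has determinant `det H ^ d`, and `P` contributes `Res ^ (M (M - 1))`
    -- to the square.
    refine ⟨(P * B).submatrix id w.symm, d * E + M * (M - 1), ?_, ?_, fun z hz j => ?_⟩
    · have h1 : (P * B).submatrix id w.symm =
          ((P.submatrix w id) * B).submatrix w.symm w.symm := by
        ext i j
        simp [Matrix.mul_apply]
      have hB : B.det = H.det ^ d := by
        rw [show B.det = (Matrix.kroneckerMap (· * ·) (1 : Matrix (Fin d) (Fin d) K) H).det from rfl,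
          Matrix.det_kronecker, Matrix.det_one, one_pow, one_mul, Fintype.card_fin]
      rw [h1, Matrix.det_submatrix_equiv_self, Matrix.det_mul, mul_pow, hB, ← pow_mul,
        mul_comm d 2, pow_mul, hdet, show (P.submatrix w id).det ^ 2 = resultant f g d d ^ (M * (M - 1)) from
          det_coeffMatrix_mixedProducts_sq hf hg M, ← pow_mul, ← pow_add, mul_comm E, add_comm]
    · have h2 : ((M * (M - 1) : ℕ) : ℝ) = M * (M - 1) := by
        rcases M with _ | M <;> simp
      push_cast [h2] at hE ⊢
      linear_combination (d : ℝ) * hE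
    · have h1 : (monomials (d * M) z ᵥ* (P * B).submatrix id w.symm) j =
          monomials d z (w.symm j).1 * (monomials M (pairMap d f g z) ᵥ* H) (w.symm j).2 := by
        obtain ⟨⟨a, c⟩, rfl⟩ := w.surjective j
        rw [Equiv.symm_apply_apply]
        have h2 : (monomials (d * M) z ᵥ* (P * B).submatrix id w.symm) (w (a, c)) =
            (monomials (d * M) z ᵥ* (P * B)) (a, c) := by
          simp [Matrix.vecMul, dotProduct]
        rw [h2, ← Matrix.vecMul_vecMul, hP, monomials_vecMul_mixedProducts hf hg]
        simp only [Matrix.vecMul, dotProduct, B, Matrix.kroneckerMap_apply, Fintype.sum_prod_type,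
          Matrix.one_apply, Finset.mul_sum]
        rw [Finset.sum_eq_single a]
        · refine Finset.sum_congr rfl fun k _ => ?_
          rw [if_pos rfl, one_mul, mul_assoc]
          rfl
        · intro b _ hb
          simp [hb]
        · simp
      obtain ⟨hΦ0, hΦG⟩ := hΦ z hz
      rw [h1, map_mul]
      refine (mul_le_mul (hmon d z hz _) (hH _ hΦ0 _) (v.nonneg _) (Real.exp_nonneg _)).trans ?_
      rw [← Real.exp_add, hΦG, Real.exp_le_exp]
      push_cast
      linarith

/-- Hadamard's inequality for the Vandermonde matrix times the adapted basis, in logarithms. Since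
`E log |Res| = N (N - 1 - α) r(F)`, of the term `N (N - 1) r(F)` in the Green sum only `α N r(F)`
survives. -/
theorem sum_homGreen_ge (v : AbsoluteValue K ℝ) {d : ℕ} (hd : 2 ≤ d)
    {F : Fin 2 → MvPolynomial (Fin 2) K} (hF : IsLift d F) {C : ℝ}
    (hC : ∀ z : Fin 2 → K, z ≠ 0 → Real.log (supNorm v z) ≤ localHeight v d F z + C)
    {t k N : ℕ} (hN : N = t * d ^ k) (z : Fin N → Fin 2 → K) (hz : ∀ i, z i ≠ 0)
    (hw : ∀ i j, i ≠ j → z i 0 * z j 1 - z i 1 * z j 0 ≠ 0) :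
    -archEps v * N * Real.log N - (2 * C + rConst v d F) * (t - 1 + (d - 1) * k) * N ≤
      ∑ i, ∑ j ∈ Finset.univ.erase i, homGreen v d F (z i) (z j) := by
  set α : ℝ := t - 1 + (d - 1) * k with hα
  set Res := homResultant d F with hRes
  have hRes0 : Res ≠ 0 := hF.homResultant_ne_zero (by omega)
  have hpair : ∀ z, pairMap d (dehom (F 0)) (dehom (F 1)) z = polyMap K F z := fun z => by
    rw [polyMap_eq_pairMap hF.homogeneous]
    simp
  obtain ⟨H, E, hdet, hE, hH⟩ := exists_adapted_basis v
    (natDegree_dehom_le (hF.homogeneous 0)) (natDegree_dehom_le (hF.homogeneous 1))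
    (G := localHeight v d F) (C := C)
    (fun z hz => (Real.log_le_iff_le_exp (supNorm_pos v hz)).1 (hC z hz))
    (fun z hz => by
      rw [hpair]
      exact ⟨hF.polyMap_ne_zero (by omega) hz, localHeight_polyMap v hd hF hz⟩) t k N hN
  rw [show resultant (dehom (F 0)) (dehom (F 1)) d d = Res from rfl] at hdet
  rw [← hα] at hE hH
  set V := Matrix.projVandermonde (fun i => z i 0) (fun i => z i 1) with hV
  have hhad := abs_det_sq_le v (V * H)
    (fun i => Real.exp ((N - 1) * localHeight v d F (z i) + α * C))
    (fun i => Real.exp_pos _) (fun i j => hH (z i) (hz i) j)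
  rw [Fintype.card_fin, ← Real.exp_sum, Matrix.det_mul, ← map_pow, mul_pow, hdet, map_mul, map_pow,
    map_pow, ← Real.exp_nat_mul, ← Real.exp_add] at hhad
  have hVdet : V.det = ∏ i, ∏ j ∈ Finset.Ioi i, (z j 0 * z i 1 - z i 0 * z j 1) :=
    Matrix.det_projVandermonde _ _
  have hne : ∀ i, ∀ j ∈ Finset.Ioi i, v (z j 0 * z i 1 - z i 0 * z j 1) ≠ 0 := fun i j hj => by
    rw [Finset.mem_Ioi] at hj
    refine v.ne_zero ?_
    have := hw j i hj.ne'
    rwa [mul_comm (z j 1)] at this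
  have hlogV : 2 * Real.log (v V.det) =
      ∑ i, ∑ j ∈ Finset.univ.erase i, Real.log (v (z i 0 * z j 1 - z i 1 * z j 0)) := by
    rw [hVdet, map_prod, Real.log_prod (fun i _ => by
      rw [map_prod]; exact Finset.prod_ne_zero_iff.2 (hne i)), Finset.mul_sum]
    have h1 := Finset.sum_sum_Ioi_add_eq_sum_sum_off_diag
      (fun j i => Real.log (v (z i 0 * z j 1 - z i 1 * z j 0)))
    simp only [Finset.compl_eq_univ_sdiff, Finset.sdiff_singleton_eq_erase] at h1
    rw [← h1]
    refine Finset.sum_congr rfl fun i _ => ?_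
    rw [map_prod, Real.log_prod (hne i), Finset.mul_sum]
    refine Finset.sum_congr rfl fun j _ => ?_
    have e1 : v (z i 0 * z j 1 - z i 1 * z j 0) = v (z j 0 * z i 1 - z i 0 * z j 1) := by
      rw [← v.map_neg]; congr 1; ring
    have e2 : v (z j 0 * z i 1 - z j 1 * z i 0) = v (z j 0 * z i 1 - z i 0 * z j 1) := by
      congr 1; ring
    rw [e1, e2]
    ring
  have hV0 : v V.det ≠ 0 := by
    rw [hVdet, map_prod]
    refine Finset.prod_ne_zero_iff.2 fun i _ => ?_
    rw [map_prod]
    exact Finset.prod_ne_zero_iff.2 (hne i)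
  have hR0 : v Res ≠ 0 := v.ne_zero hRes0
  have hlog : 2 * Real.log (v V.det) + E * Real.log (v Res) ≤
      archEps v * N * Real.log N +
        2 * ∑ i, ((N - 1) * localHeight v d F (z i) + α * C) := by
    have hpos : 0 < v V.det ^ 2 * v Res ^ E := by
      have h1 : 0 < v V.det := lt_of_le_of_ne (v.nonneg _) hV0.symm
      have h2 : 0 < v Res := lt_of_le_of_ne (v.nonneg _) hR0.symm
      positivity
    have := Real.log_le_log hpos hhad
    rw [Real.log_exp, Real.log_mul (pow_ne_zero _ hV0) (pow_ne_zero _ hR0), Real.log_pow,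
      Real.log_pow] at this
    exact_mod_cast this
  rw [hlogV] at hlog
  have hcard : ∀ i : Fin N, ((Finset.univ.erase i).card : ℝ) = N - 1 := fun i => by
    rw [Finset.card_erase_of_mem (Finset.mem_univ i), Finset.card_fin, Nat.cast_sub, Nat.cast_one]
    have := i.2
    omega
  have hEr : E * Real.log (v Res) = N * (N - 1 - α) * rConst v d F := by
    have h2 : (2 : ℝ) ≤ d := by exact_mod_cast hd
    have hd0 : (d : ℝ) ≠ 0 := by linarith
    have hd1 : (d : ℝ) - 1 ≠ 0 := by linarith
    rw [← hE, rConst, ← hRes]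
    field_simp
  have hsumH : ∑ i, ∑ j ∈ Finset.univ.erase i, localHeight v d F (z j) =
      (N - 1) * ∑ i, localHeight v d F (z i) := by
    have : ∀ i, ∑ j ∈ Finset.univ.erase i, localHeight v d F (z j) =
        ∑ j, localHeight v d F (z j) - localHeight v d F (z i) := fun i => by
      rw [← Finset.add_sum_erase _ _ (Finset.mem_univ i)]; ring
    simp only [this, Finset.sum_sub_distrib, Finset.sum_const, Finset.card_fin, nsmul_eq_mul]
    ring
  have hgreen : ∑ i, ∑ j ∈ Finset.univ.erase i, homGreen v d F (z i) (z j) =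
      -∑ i, ∑ j ∈ Finset.univ.erase i, Real.log (v (z i 0 * z j 1 - z i 1 * z j 0)) +
        2 * (N - 1) * ∑ i, localHeight v d F (z i) - N * (N - 1) * rConst v d F := by
    simp only [homGreen, Finset.sum_sub_distrib, Finset.sum_add_distrib, Finset.sum_neg_distrib,
      hsumH, Finset.sum_const, nsmul_eq_mul, hcard, Finset.card_fin, ← Finset.mul_sum]
    ring
  rw [hEr] at hlog
  rw [hgreen]
  simp only [Finset.sum_add_distrib, ← Finset.mul_sum, Finset.sum_const, Finset.card_fin,
    nsmul_eq_mul] at hlog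
  linarith

end LowerBound

/-! ### Projective points and extended-real sums. -/

section Points

variable {K : Type*} [Field K]

theorem wedge_rep_ne_zero {P Q : Projectivization K (Fin 2 → K)} (h : P ≠ Q) :
    P.rep 0 * Q.rep 1 - P.rep 1 * Q.rep 0 ≠ 0 := by
  intro h0
  have h1 : P.rep 0 * Q.rep 1 = P.rep 1 * Q.rep 0 := sub_eq_zero.1 h0
  refine h ?_
  rw [← P.mk_rep, ← Q.mk_rep, Projectivization.mk_eq_mk_iff']
  obtain ⟨i, hi⟩ := Function.ne_iff.1 Q.rep_nonzero
  simp only [Pi.zero_apply] at hi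
  refine ⟨P.rep i / Q.rep i, ?_⟩
  ext j
  rw [Pi.smul_apply, smul_eq_mul, div_mul_eq_mul_div, div_eq_iff hi]
  fin_cases i <;> fin_cases j <;> simp only [Fin.zero_eta, Fin.mk_one] <;>
    first | rfl | exact h1 | exact h1.symm

theorem ereal_coe_sum {ι : Type*} (s : Finset ι) (f : ι → ℝ) :
    ((∑ i ∈ s, f i : ℝ) : EReal) = ∑ i ∈ s, (f i : EReal) := by
  classical
  induction s using Finset.induction_on with
  | empty => simp
  | insert a s ha ih => rw [Finset.sum_insert ha, Finset.sum_insert ha, EReal.coe_add, ih]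

theorem ereal_sum_ne_bot {ι : Type*} (s : Finset ι) (f : ι → EReal) (h : ∀ i ∈ s, f i ≠ ⊥) :
    ∑ i ∈ s, f i ≠ ⊥ :=
  Finset.sum_induction f (· ≠ ⊥) (fun _ _ ha hb => EReal.add_ne_bot_iff.2 ⟨ha, hb⟩)
    EReal.zero_ne_bot h

theorem ereal_sum_eq_top {ι : Type*} {s : Finset ι} {f : ι → EReal} (h : ∀ i ∈ s, f i ≠ ⊥)
    {a : ι} (ha : a ∈ s) (hfa : f a = ⊤) : ∑ i ∈ s, f i = ⊤ := by
  classical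
  rw [← Finset.add_sum_erase s f ha, hfa, EReal.top_add_of_ne_bot]
  exact ereal_sum_ne_bot _ _ fun i hi => h i (Finset.mem_of_mem_erase hi)

variable (v : AbsoluteValue K ℝ) (d : ℕ) (F : Fin 2 → MvPolynomial (Fin 2) K)

theorem green_ne_bot (P Q : Projectivization K (Fin 2 → K)) : green v d F P Q ≠ ⊥ := by
  rw [green]
  split_ifs
  · exact top_ne_bot
  · exact EReal.coe_ne_bot _

theorem greenSum_of_injective {N : ℕ} {z : Fin N → Projectivization K (Fin 2 → K)}
    (hz : Function.Injective z) : greenSum v d F z =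
      ((∑ i, ∑ j ∈ Finset.univ.erase i, homGreen v d F (z i).rep (z j).rep : ℝ) : EReal) := by
  rw [greenSum, ereal_coe_sum]
  refine Finset.sum_congr rfl fun i _ => ?_
  rw [ereal_coe_sum]
  refine Finset.sum_congr rfl fun j hj => ?_
  rw [green, if_neg fun h => Finset.ne_of_mem_erase hj (hz h).symm]

/-- A coincidence contributes `⊤`, and no term is `⊥`, which would absorb it in `EReal`. -/
theorem greenSum_of_not_injective {N : ℕ} {z : Fin N → Projectivization K (Fin 2 → K)}
    (hz : ¬ Function.Injective z) : greenSum v d F z = ⊤ := by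
  simp only [Function.Injective, not_forall] at hz
  obtain ⟨i, j, hij, hne⟩ := hz
  refine ereal_sum_eq_top (fun i _ => ereal_sum_ne_bot _ _ fun j _ => green_ne_bot v d F _ _)
    (Finset.mem_univ i) ?_
  refine ereal_sum_eq_top (fun j _ => green_ne_bot v d F _ _)
    (Finset.mem_erase.2 ⟨Ne.symm hne, Finset.mem_univ j⟩) ?_
  rw [green, if_pos hij]

end Points

/-! ### The filled Julia set and its radius. -/

section FilledJulia

variable {K : Type*} [Field K] {d : ℕ} {F : Fin 2 → MvPolynomial (Fin 2) K}
  {L : Type*} [Field L] [Algebra K L]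

/-- Outside the radius `max 1 (2 B)` the map at least doubles norms, because `d ≥ 2`, so the orbit
escapes. -/
theorem bddAbove_supNorm_filledJulia (w : AbsoluteValue L ℝ) (hd : 2 ≤ d) (hF : IsLift d F) :
    ∃ r, ∀ z ∈ filledJulia w F, supNorm w z ≤ r := by
  obtain ⟨A, -, B, hB, hAB⟩ := exists_supNorm_polyMap_bounds (L := L) w (by omega) hF
  refine ⟨max 1 (2 * B), fun z hz => ?_⟩
  by_contra! hlt
  have hgrow : ∀ z : Fin 2 → L, max 1 (2 * B) < supNorm w z →
      2 * supNorm w z ≤ supNorm w (polyMap L F z) := fun z hz => by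
    obtain ⟨h1, h2⟩ := max_lt_iff.1 hz
    have h3 : supNorm w z ^ 2 ≤ B * supNorm w (polyMap L F z) :=
      (pow_le_pow_right₀ h1.le hd).trans (hAB z).2
    have h4 : B * (2 * supNorm w z) ≤ supNorm w z ^ 2 := by nlinarith
    exact le_of_mul_le_mul_left (h4.trans h3) hB
  have h2n : ∀ n : ℕ, 2 ^ n * supNorm w z ≤ supNorm w ((polyMap L F)^[n] z) := fun n => by
    induction n with
    | zero => simp
    | succ n ih =>
      rw [Function.iterate_succ_apply']
      have h0 := supNorm_nonneg w z
      have h1 : supNorm w z ≤ 2 ^ n * supNorm w z :=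
        le_mul_of_one_le_left h0 (one_le_pow₀ (by norm_num))
      have := hgrow _ (hlt.trans_le (h1.trans ih))
      rw [pow_succ]
      linarith
  obtain ⟨b, hb⟩ := hz
  obtain ⟨n, hn⟩ := pow_unbounded_of_one_lt b (by norm_num : (1 : ℝ) < 2)
  have h1 : (1 : ℝ) < supNorm w z := (le_max_left _ _).trans_lt hlt
  have h2 : (2 : ℝ) ^ n ≤ 2 ^ n * supNorm w z := le_mul_of_one_le_right (by positivity) h1.le
  linarith [hb n, h2n n]

theorem zero_mem_filledJulia (w : AbsoluteValue L ℝ) (hd : 0 < d) (hF : IsLift d F) :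
    (0 : Fin 2 → L) ∈ filledJulia w F := by
  have h : ∀ n, (polyMap L F)^[n] (0 : Fin 2 → L) = 0 := fun n => by
    have := iterate_polyMap_smul (L := L) hF.homogeneous 0 0 n
    rwa [smul_zero, zero_pow (pow_ne_zero _ hd.ne'), zero_smul] at this
  exact ⟨0, fun n => by rw [h]; simp [supNorm]⟩

theorem exists_isLeast_radius (w : AbsoluteValue L ℝ) (hd : 2 ≤ d) (hF : IsLift d F) :
    ∃ R : ℝ, IsLeast {ρ : ℝ | ∀ z ∈ filledJulia w F, supNorm w z ≤ ρ} R := by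
  have h : {ρ : ℝ | ∀ z ∈ filledJulia w F, supNorm w z ≤ ρ} =
      upperBounds (supNorm w '' filledJulia w F) := by
    ext ρ
    simp [mem_upperBounds]
  rw [h]
  refine ⟨_, isLUB_csSup ⟨_, 0, zero_mem_filledJulia w (by omega) hF, rfl⟩ ?_⟩
  obtain ⟨r, hr⟩ := bddAbove_supNorm_filledJulia w hd hF
  exact ⟨r, h.le hr⟩

theorem supNorm_algebraMap {v : AbsoluteValue K ℝ} {w : AbsoluteValue L ℝ}
    (hw : ∀ x : K, w (algebraMap K L x) = v x) (z : Fin 2 → K) :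
    supNorm w (algebraMap K L ∘ z) = supNorm v z := by
  simp [supNorm, hw]

/-- The height of `c z` is `log |c| + H(z)`; when it is negative, the iterates eventually have norm
at most `1`. -/
theorem smul_mem_filledJulia {v : AbsoluteValue K ℝ} {w : AbsoluteValue L ℝ}
    (hw : ∀ x : K, w (algebraMap K L x) = v x) (hd : 2 ≤ d) (hF : IsLift d F) {z : Fin 2 → K}
    (hz : z ≠ 0) {c : L} (hc : c ≠ 0) (h : Real.log (w c) + localHeight v d F z < 0) :
    c • (algebraMap K L ∘ z) ∈ filledJulia w F := by
  obtain ⟨C, hC⟩ := exists_tendsto_localHeight v hd hF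
  have hd0 : (0 : ℝ) < d := by exact_mod_cast (by omega : 0 < d)
  have hev := ((hC z hz).1.const_add (Real.log (w c))).eventually (gt_mem_nhds h)
  obtain ⟨n₀, hn₀⟩ := eventually_atTop.1 hev
  have hle : ∀ n ≥ n₀, supNorm w ((polyMap L F)^[n] (c • (algebraMap K L ∘ z))) ≤ 1 :=
    fun n hn => by
      have h1 := hn₀ n hn
      rw [iterate_polyMap_smul hF.homogeneous, iterate_polyMap_algebraMap, supNorm_smul,
        supNorm_algebraMap hw, map_pow]
      have hs := supNorm_pos v (hF.iterate_polyMap_ne_zero (by omega) hz n)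
      have hwc : 0 < w c := w.pos hc
      have hpos : 0 < w c ^ d ^ n * supNorm v ((polyMap K F)^[n] z) := by positivity
      rw [← Real.log_nonpos_iff hpos.le, Real.log_mul (by positivity) hs.ne', Real.log_pow]
      push_cast
      have hdn : (0 : ℝ) < (d : ℝ) ^ n := by positivity
      have h2 : (d : ℝ) ^ n * Real.log (w c) + Real.log (supNorm v ((polyMap K F)^[n] z)) =
          (d : ℝ) ^ n * (Real.log (w c) +
            1 / (d : ℝ) ^ n * Real.log (supNorm v ((polyMap K F)^[n] z))) := by
        field_simp
      rw [h2]
      exact (mul_neg_of_pos_of_neg hdn h1).le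
  refine ⟨1 + ∑ n ∈ Finset.range n₀, supNorm w ((polyMap L F)^[n] (c • (algebraMap K L ∘ z))),
    fun n => ?_⟩
  rcases lt_or_ge n n₀ with hn | hn
  · have := Finset.single_le_sum
      (f := fun n => supNorm w ((polyMap L F)^[n] (c • (algebraMap K L ∘ z))))
      (fun n _ => supNorm_nonneg w _) (Finset.mem_range.2 hn)
    linarith
  · have : 0 ≤ ∑ n ∈ Finset.range n₀, supNorm w ((polyMap L F)^[n] (c • (algebraMap K L ∘ z))) :=
      Finset.sum_nonneg fun n _ => supNorm_nonneg w _
    linarith [hle n hn]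

theorem supNorm_eq_one_of_trivial {v : AbsoluteValue K ℝ} (hv : ∀ x : K, x ≠ 0 → v x = 1)
    {z : Fin 2 → K} (hz : z ≠ 0) : supNorm v z = 1 := by
  have h1 : ∀ x, v x ≤ 1 := fun x => by
    rcases eq_or_ne x 0 with rfl | hx
    · simp
    · exact (hv x hx).le
  refine le_antisymm (supNorm_le fun i => h1 _) ?_
  obtain ⟨i, hi⟩ := Function.ne_iff.1 hz
  exact (hv _ hi).ge.trans (le_supNorm v z i)

/-- The radius of the filled Julia set is positive and its logarithm bounds `log‖z‖ - H(z)`. -/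
theorem radius_pos_and_log_supNorm_le {v : AbsoluteValue K ℝ} {w : AbsoluteValue L ℝ}
    (hw : ∀ x : K, w (algebraMap K L x) = v x) (hw' : TrivialOrDense w) (hd : 2 ≤ d)
    (hF : IsLift d F) {R : ℝ} (hR : ∀ z ∈ filledJulia w F, supNorm w z ≤ R) :
    0 < R ∧ ∀ z : Fin 2 → K, z ≠ 0 →
      Real.log (supNorm v z) ≤ localHeight v d F z + Real.log R := by
  have he : (![1, 0] : Fin 2 → K) ≠ 0 := fun h => one_ne_zero (congrFun h 0)
  have heL : (![1, 0] : Fin 2 → L) ≠ 0 := fun h => one_ne_zero (congrFun h 0)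
  rcases hw' with htriv | hdense
  · have hv : ∀ x : K, x ≠ 0 → v x = 1 := fun x hx => by
      rw [← hw]; exact htriv _ ((map_ne_zero _).2 hx)
    have hle : ∀ y : Fin 2 → L, supNorm w y ≤ 1 := fun y => by
      rcases eq_or_ne y 0 with rfl | hy
      · simp [supNorm]
      · exact (supNorm_eq_one_of_trivial htriv hy).le
    have h1R : 1 ≤ R := by
      have := hR ![1, 0] ⟨1, fun n => hle _⟩
      rwa [supNorm_eq_one_of_trivial htriv heL] at this
    refine ⟨by linarith, fun z hz => ?_⟩
    obtain ⟨C, hC⟩ := exists_tendsto_localHeight v hd hF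
    have h0 : localHeight v d F z = 0 := by
      refine tendsto_nhds_unique (hC z hz).1 (tendsto_const_nhds.congr fun n => ?_)
      rw [supNorm_eq_one_of_trivial hv (hF.iterate_polyMap_ne_zero (by omega) hz n), Real.log_one,
        mul_zero]
    rw [h0, supNorm_eq_one_of_trivial hv hz, Real.log_one, zero_add]
    exact Real.log_nonneg h1R
  -- Density supplies a scalar `c` with `log |c|` within `δ` below `-H(z)`. Then `c z` lies in the
  -- filled Julia set, so `log |c| + log ‖z‖ ≤ log R`, and `δ` tends to `0`.
  · have key : ∀ z : Fin 2 → K, z ≠ 0 → ∀ δ > 0, ∃ c : L, c ≠ 0 ∧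
        -localHeight v d F z - δ < Real.log (w c) ∧ w c * supNorm v z ≤ R := fun z hz δ hδ => by
      obtain ⟨c, hc1, hc2⟩ := hdense (Real.exp (-localHeight v d F z - δ))
        (Real.exp (-localHeight v d F z)) (Real.exp_pos _) (Real.exp_lt_exp.2 (by linarith))
      have hwc : 0 < w c := (Real.exp_pos _).trans hc1
      have hc : c ≠ 0 := w.ne_zero_iff.1 hwc.ne'
      refine ⟨c, hc, (Real.lt_log_iff_exp_lt hwc).2 hc1, ?_⟩
      have h1 := (Real.log_lt_iff_lt_exp hwc).2 hc2
      have h2 := hR _ (smul_mem_filledJulia hw hd hF hz hc (by linarith))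
      rwa [supNorm_smul, supNorm_algebraMap hw] at h2
    have hRpos : 0 < R := by
      obtain ⟨c, hc, -, h⟩ := key _ he 1 one_pos
      exact (mul_pos (w.pos hc) (supNorm_pos v he)).trans_le h
    refine ⟨hRpos, fun z hz => le_of_forall_pos_le_add fun δ hδ => ?_⟩
    obtain ⟨c, hc, h1, h2⟩ := key z hz δ hδ
    have h3 := Real.log_le_log (mul_pos (w.pos hc) (supNorm_pos v hz)) h2
    rw [Real.log_mul (w.pos hc).ne' (supNorm_pos v hz).ne'] at h3
    linarith

end FilledJulia

/-! ### Averaging over subsets and the limit inferior. -/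

section Averages

/-- Each ordered pair of distinct points survives the removal of exactly the other `card - 2`
points. -/
theorem sum_offDiag_erase {ι : Type*} [DecidableEq ι] (S : Finset ι) (a : ι × ι → ℝ) :
    ∑ l ∈ S, ∑ p ∈ (S.erase l).offDiag, a p = ((S.card : ℝ) - 2) * ∑ p ∈ S.offDiag, a p := by
  rw [Finset.sum_comm' (s' := fun p => (S.erase p.1).erase p.2) (t' := S.offDiag) (by
    rintro l ⟨p, q⟩
    simp only [Finset.mem_offDiag, Finset.mem_erase]
    tauto), Finset.mul_sum]
  refine Finset.sum_congr rfl fun p hp => ?_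
  obtain ⟨h1, h2, h3⟩ := Finset.mem_offDiag.1 hp
  have hc1 := Finset.card_erase_add_one h1
  have hc2 := Finset.card_erase_add_one (Finset.mem_erase.2 ⟨Ne.symm h3, h2⟩)
  have hc : (((S.erase p.1).erase p.2).card : ℝ) = S.card - 2 := by
    rw [← hc1, ← hc2]; push_cast; ring
  rw [Finset.sum_const, nsmul_eq_mul, hc]

/-- A lower bound for the averages over pairs in sets of a given size holds for larger sets. -/
theorem le_sum_offDiag_of_card_le {ι : Type*} [DecidableEq ι] {a : ι × ι → ℝ} {c : ℝ} {M : ℕ}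
    (hM : 2 ≤ M)
    (h : ∀ S : Finset ι, S.card = M → c * (M * (M - 1)) ≤ ∑ p ∈ S.offDiag, a p) :
    ∀ S : Finset ι, M ≤ S.card → c * (S.card * (S.card - 1)) ≤ ∑ p ∈ S.offDiag, a p := by
  suffices ∀ n, M ≤ n → ∀ S : Finset ι, S.card = n → c * (n * (n - 1)) ≤ ∑ p ∈ S.offDiag, a p from
    fun S hS => this _ hS S rfl
  intro n hn
  induction n, hn using Nat.le_induction with
  | base => exact h
  | succ n hn ih =>
    intro S hS
    have h1 : ∑ _l ∈ S, c * (n * (n - 1) : ℝ) ≤ ∑ l ∈ S, ∑ p ∈ (S.erase l).offDiag, a p :=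
      Finset.sum_le_sum fun l hl => ih _ (by rw [Finset.card_erase_of_mem hl, hS]; rfl)
    rw [sum_offDiag_erase, Finset.sum_const, nsmul_eq_mul, hS] at h1
    push_cast at h1 ⊢
    have hn1 : (0 : ℝ) < n - 1 := by
      have : (2 : ℝ) ≤ n := by exact_mod_cast hM.trans hn
      linarith
    refine le_of_mul_le_mul_left ?_ hn1
    linarith

theorem sum_sum_erase_eq_offDiag {ι : Type*} [Fintype ι] [DecidableEq ι] (a : ι → ι → ℝ) :
    ∑ i, ∑ j ∈ Finset.univ.erase i, a i j = ∑ p ∈ Finset.univ.offDiag, a p.1 p.2 := by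
  refine (Finset.sum_finset_product (f := fun p : ι × ι => a p.1 p.2) Finset.univ.offDiag
    Finset.univ (fun i => Finset.univ.erase i) fun p => ?_).symm
  simp [Finset.mem_offDiag, eq_comm]

theorem sum_offDiag_map {ι κ : Type*} [DecidableEq ι] [DecidableEq κ] (e : κ ↪ ι) (S : Finset κ)
    (a : ι × ι → ℝ) : ∑ p ∈ (S.map e).offDiag, a p = ∑ p ∈ S.offDiag, a (e p.1, e p.2) := by
  refine (Finset.sum_nbij (fun p : κ × κ => (e p.1, e p.2)) ?_ ?_ ?_ fun _ _ => rfl).symm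
  · rintro ⟨i, j⟩ h
    simpa [Finset.mem_offDiag] using h
  · rintro ⟨i, j⟩ - ⟨i', j'⟩ - h
    simpa using h
  · rintro ⟨i, j⟩ h
    simp only [Finset.coe_offDiag, Set.mem_offDiag, Finset.coe_map, Set.mem_image] at h
    obtain ⟨⟨i, hi, rfl⟩, ⟨j, hj, rfl⟩, hne⟩ := h
    refine ⟨(i, j), ?_, rfl⟩
    simp only [Finset.coe_offDiag, Set.mem_offDiag]
    exact ⟨hi, hj, fun h => hne (congrArg e h)⟩

theorem exists_linear_le_mul_pow {a b ε q : ℝ} (hε : 0 < ε) (hq : 1 < q) :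
    ∃ k : ℕ, 1 ≤ k ∧ a + b * k ≤ ε * q ^ k := by
  have h := ((tendsto_pow_const_div_const_pow_of_one_lt 0 hq).const_mul a).add
    ((tendsto_pow_const_div_const_pow_of_one_lt 1 hq).const_mul b)
  obtain ⟨k, hk, hk1⟩ := ((h.eventually (gt_mem_nhds (show a * 0 + b * 0 < ε by simpa))).and
    (eventually_ge_atTop 1)).exists
  refine ⟨k, hk1, ?_⟩
  have hpos : 0 < q ^ k := by positivity
  rw [pow_zero, pow_one, ← mul_div_assoc, ← mul_div_assoc, ← add_div, div_lt_iff₀ hpos] at hk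
  linarith

variable {K : Type*} [Field K] (v : AbsoluteValue K ℝ) {d : ℕ} {F : Fin 2 → MvPolynomial (Fin 2) K}

/-- The average of the Green's function over large sets of points is almost nonnegative. -/
theorem exists_card_forall_le_greenSum (hd : 2 ≤ d) (hF : IsLift d F) {ε : ℝ} (hε : 0 < ε) :
    ∃ M : ℕ, 2 ≤ M ∧ ∀ N, M ≤ N → ∀ z : Fin N → Projectivization K (Fin 2 → K),
      ((-ε * (N * (N - 1)) : ℝ) : EReal) ≤ greenSum v d F z := by
  obtain ⟨C, hC⟩ := exists_tendsto_localHeight v hd hF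
  have hC' : ∀ z : Fin 2 → K, z ≠ 0 → Real.log (supNorm v z) ≤ localHeight v d F z + C :=
    fun z hz => by linarith [(abs_le.1 (hC z hz).2).2]
  have hd1 : (1 : ℝ) < d := by exact_mod_cast (by omega : 1 < d)
  -- With `t = 2` and `M = 2 d ^ k`, both `log M` and `α = 1 + (d - 1) k` are affine in `k`; `a` and
  -- `b` collect the coefficients of the loss per point, to be beaten by `ε d ^ k ≤ ε (M - 1)`.
  obtain ⟨k, hk1, hk⟩ := exists_linear_le_mul_pow
    (a := archEps v * Real.log 2 + (2 * C + rConst v d F))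
    (b := archEps v * Real.log d + (2 * C + rConst v d F) * (d - 1)) hε hd1
  have hdk : 1 ≤ d ^ k := Nat.one_le_pow _ _ (by omega)
  obtain ⟨M, hM⟩ : ∃ M, M = 2 * d ^ k := ⟨_, rfl⟩
  have hM2 : 2 ≤ M := by omega
  refine ⟨M, hM2, fun N hN z => ?_⟩
  by_cases hz : Function.Injective z
  · rw [greenSum_of_injective v d F hz, EReal.coe_le_coe_iff, sum_sum_erase_eq_offDiag]
    have h := le_sum_offDiag_of_card_le (ι := Fin N) (c := -ε)
      (a := fun p => homGreen v d F (z p.1).rep (z p.2).rep) hM2 (fun S hS => ?_) Finset.univ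
      (by simpa using hN)
    · simpa using h
    · let e : Fin M ↪ Fin N := (S.orderEmbOfFin hS).toEmbedding
      have hSe : S = Finset.univ.map e := (Finset.map_orderEmbOfFin_univ S hS).symm
      have h1 := sum_homGreen_ge v hd hF hC' hM (fun i => (z (e i)).rep)
        (fun i => (z (e i)).rep_nonzero)
        (fun i j hij => wedge_rep_ne_zero fun h => hij (e.injective (hz h)))
      rw [sum_sum_erase_eq_offDiag] at h1
      rw [hSe, sum_offDiag_map]
      refine le_trans ?_ h1
      have hMr : (M : ℝ) = 2 * (d : ℝ) ^ k := by exact_mod_cast hM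
      have hlog : Real.log M = Real.log 2 + k * Real.log d := by
        rw [hMr, Real.log_mul (by norm_num) (by positivity), Real.log_pow]
      have hM1 : (d : ℝ) ^ k ≤ M - 1 := by
        have : (1 : ℝ) ≤ (d : ℝ) ^ k := by exact_mod_cast hdk
        linarith
      have h2 : archEps v * Real.log M + (2 * C + rConst v d F) * (1 + (d - 1) * k) ≤
          ε * (M - 1) := by
        rw [hlog]
        have := mul_le_mul_of_nonneg_left hM1 hε.le
        linarith
      have h3 := mul_le_mul_of_nonneg_left h2 (Nat.cast_nonneg (α := ℝ) M)
      push_cast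
      linarith
  · rw [greenSum_of_not_injective v d F hz]
    exact le_top

theorem liminf_average_greenSum_nonneg (hd : 2 ≤ d) (hF : IsLift d F) :
    (0 : EReal) ≤ liminf (fun N : ℕ =>
      ⨅ z : Fin N → Projectivization K (Fin 2 → K),
        ((1 / ((N : ℝ) * ((N : ℝ) - 1)) : ℝ) : EReal) * greenSum v d F z) atTop := by
  refine EReal.ge_of_forall_gt_iff_ge.1 fun x hx => ?_
  have hε : 0 < -x := by
    have : x < 0 := by exact_mod_cast hx
    linarith
  obtain ⟨M, hM2, hM⟩ := exists_card_forall_le_greenSum v hd hF hε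
  refine le_liminf_of_le (h := ?_)
  filter_upwards [eventually_ge_atTop M] with N hN
  refine le_iInf fun z => ?_
  have hN2 : (2 : ℝ) ≤ N := by exact_mod_cast hM2.trans hN
  have hpos : 0 < (N : ℝ) * (N - 1) := mul_pos (by linarith) (by linarith)
  calc (x : EReal) = ((1 / ((N : ℝ) * (N - 1)) : ℝ) : EReal) *
        ((- -x * (N * (N - 1)) : ℝ) : EReal) := by
        rw [← EReal.coe_mul]
        rw [neg_neg, one_div, mul_comm x, inv_mul_cancel_left₀ hpos.ne']
    _ ≤ _ := mul_le_mul_of_nonneg_left (hM N hN z) (EReal.coe_nonneg.2 (by positivity))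

end Averages

end DynGreen

end

theorem corollary2p3 {K : Type*} [Field K] (v : AbsoluteValue K ℝ) (d : ℕ) (hd : 2 ≤ d)
    (F : Fin 2 → MvPolynomial (Fin 2) K) (hF : DynGreen.IsLift d F) :
    (∀ (L : Type*) [Field L] [Algebra K L] (w : AbsoluteValue L ℝ),
      (∀ x : K, w (algebraMap K L x) = v x) → DynGreen.TrivialOrDense w →
      ∃ R : ℝ,
        IsLeast {ρ : ℝ | ∀ z ∈ DynGreen.filledJulia w F, DynGreen.supNorm w z ≤ ρ} R ∧
        0 < R ∧
        ∀ N t k : ℕ, 2 ≤ t → t ≤ 2 * d - 1 → 1 ≤ k → N = t * d ^ k →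
          ∀ α : ℝ, α = (t : ℝ) - 1 + ((d : ℝ) - 1) * k →
          ∀ z : Fin N → Projectivization K (Fin 2 → K), Function.Injective z →
            ((-DynGreen.archEps v * N * Real.log N
                - (2 * Real.log R + DynGreen.rConst v d F) * α * N : ℝ) : EReal)
              ≤ DynGreen.greenSum v d F z) ∧
    (0 : EReal) ≤ liminf (fun N : ℕ =>
      ⨅ z : Fin N → Projectivization K (Fin 2 → K),
        ((1 / ((N : ℝ) * ((N : ℝ) - 1)) : ℝ) : EReal) * DynGreen.greenSum v d F z) atTop := by
  refine ⟨fun L _ _ w hw hw' => ?_, DynGreen.liminf_average_greenSum_nonneg v hd hF⟩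
  obtain ⟨R, hR⟩ := DynGreen.exists_isLeast_radius (L := L) w hd hF
  obtain ⟨hR0, hlog⟩ := DynGreen.radius_pos_and_log_supNorm_le hw hw' hd hF hR.1
  refine ⟨R, hR, hR0, fun N t k _ _ _ hN α hα z hz => ?_⟩
  rw [DynGreen.greenSum_of_injective v d F hz, EReal.coe_le_coe_iff, hα]
  -- Here the constant `C` is `log R`.
  exact DynGreen.sum_homGreen_ge v hd hF hlog hN (fun i => (z i).rep)
    (fun i => (z i).rep_nonzero) fun i j hij => DynGreen.wedge_rep_ne_zero fun h => hij (hz h)
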